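/- Let $\alpha>0$, $\gamma>0$, and let $A,B$ be real constants with $A\ge 0$, $A+B\ge 0$ and $(A,B)\neq(0,0)$. Let $\theta(x)=1$ for $x>0$ and $\theta(x)=0$ otherwise, and for $x,t\ge 0$ put $$w(x,t)=x^{\alpha}e^{-x}|x-t|^{\gamma}\bigl(A+B\,\theta(x-t)\bigr),\qquad D_n(t)=\det\left(\int_0^\infty x^{i+j}w(x,t)\,dx\right)_{i,j=0}^{n-1}\quad(n\ge 0,\ D_0=1).$$ Let $I=[0,\infty)$ if $A+B>0$ and $I=(0,\infty)$ if $A+B=0$. Then, for every $n\ge 0$, $D_n$ is positive and differentiable on $I$ (one-sidedly at $t=0$), so that $$H_n(t)=t\frac{d}{dt}\ln D_n(t),\qquad \sigma_n(t)=H_n(t)-n\gamma\qquad (t\in I)$$ are well defined, and $H_n$, $\sigma_n$ are twice differentiable on $(0,\infty)$. Moreover: (i) For all $n\ge 0$ and $t>0$, $\sigma_n$ satisfies the Jimbo–Miwa–Okamoto $\sigma$-form of Painlevé V, $$(t\sigma_n'')^2=\left[\sigma_n-t\sigma_n'+2(\sigma_n')^2+(\nu_0+\nu_1+\nu_2+\nu_3)\sigma_n'\right]^2-4(\nu_0+\sigma_n')(\nu_1+\sigma_n')(\nu_2+\sigma_n')(\nu_3+\sigma_n'),$$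 with $\nu_0=0$, $\nu_1=n$, $\nu_2=n+\alpha$, $\nu_3=-\gamma$; equivalently, $H_n$ satisfies $$(tH_n'')^2=\left[n\gamma-H_n-(2n+\alpha+\gamma-t)H_n'\right]^2-4\left[n(n+\alpha+\gamma)-H_n+tH_n'\right]\left[(H_n')^2-\gamma H_n'\right].$$ (ii) If $A+B>0$, then for all $n\ge 0$ the initial conditions $\sigma_n(0)=-n\gamma$, $\sigma_n'(0)=-\frac{n\gamma}{\alpha+\gamma}$ and $H_n(0)=0$, $H_n'(0)=-\frac{n\gamma}{\alpha+\gamma}$ hold, the derivatives at $0$ being right derivatives. (iii) For all $n\ge 1$ and $t\in I$, $\sigma_n$ satisfies the second-order difference equation in $n$ (the discrete $\sigma$-form of Painlevé V) $$\begin{aligned}&\bigl[t\sigma_n-(n^2+n\alpha-\sigma_n)(2\gamma-\sigma_{n-1}+\sigma_{n+1})\bigr]\bigl[(2n+\alpha+\gamma-t)\gamma t+t\sigma_n-(n^2+n\alpha+\gamma t-\sigma_n)(2\gamma-\sigma_{n-1}+\sigma_{n+1})\bigr]\\&=\bigl[n(n+\alpha)(2n+\alpha+\gamma-t)-(2n+\alpha+\gamma)\sigma_n\bigr](2n+\alpha-\gamma-t+\sigma_{n-1}-\sigma_{n+1})(\gamma-\sigma_n+\sigma_{n+1})(\gamma-\sigma_{n-1}+\sigma_n),\end{aligned}$$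 and $H_n$ satisfies $$\begin{aligned}&\bigl\{n\gamma t-tH_n-[n(n+\alpha+\gamma)-H_n](H_{n-1}-H_{n+1})\bigr\}\bigl\{(t-n-\alpha-\gamma)\gamma t-tH_n-[n(n+\alpha+\gamma)+\gamma t-H_n](H_{n-1}-H_{n+1})\bigr\}\\&=\bigl[n\gamma t+n(n+\alpha+\gamma)(2n+\alpha+\gamma-t)-(2n+\alpha+\gamma)H_n\bigr](2n+\alpha+\gamma-t+H_{n-1}-H_{n+1})(H_n-H_{n+1})(H_{n-1}-H_n).\end{aligned}$$ -/

import Mathlib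

open MeasureTheory Set

noncomputable section

namespace PerturbedLaguerre

/-- The Heaviside step function: `1` for `x > 0` and `0` otherwise. -/
def heaviside (x : ℝ) : ℝ := if 0 < x then 1 else 0

/-- The perturbed Laguerre weight `w(x,t) = x^α e^{-x} |x-t|^γ (A + B θ(x-t))`, for `x, t ≥ 0`. -/
def weight (α γ A B x t : ℝ) : ℝ :=
  x ^ α * Real.exp (-x) * |x - t| ^ γ * (A + B * heaviside (x - t))

/-- The Hankel determinant `D_n(t) = det (∫_0^∞ x^{i+j} w(x,t) dx)_{i,j=0}^{n-1}`. -/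
def hankelDet (α γ A B : ℝ) (n : ℕ) (t : ℝ) : ℝ :=
  Matrix.det (Matrix.of fun i j : Fin n =>
    ∫ x in Ioi (0 : ℝ), x ^ ((i : ℕ) + (j : ℕ)) * weight α γ A B x t)

/-- `H_n(t) = t (d/dt) ln D_n(t)` on `[0, ∞)`; the derivative is the usual one for `t > 0` and the
right derivative at `t = 0`. -/
def H (α γ A B : ℝ) (n : ℕ) (t : ℝ) : ℝ :=
  t * derivWithin (fun s => Real.log (hankelDet α γ A B n s)) (Ici 0) t

/-- `σ_n(t) = H_n(t) - n γ`. -/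
def sigma (α γ A B : ℝ) (n : ℕ) (t : ℝ) : ℝ := H α γ A B n t - n * γ

/-- The Jimbo-Miwa-Okamoto `σ`-form of Painlevé V with parameters `ν₀, ν₁, ν₂, ν₃`, for a function
`f` at the point `t`. -/
def SigmaFormPVAt (ν₀ ν₁ ν₂ ν₃ : ℝ) (f : ℝ → ℝ) (t : ℝ) : Prop :=
  (t * deriv (deriv f) t) ^ 2 =
    (f t - t * deriv f t + 2 * (deriv f t) ^ 2 + (ν₀ + ν₁ + ν₂ + ν₃) * deriv f t) ^ 2
      - 4 * (ν₀ + deriv f t) * (ν₁ + deriv f t) * (ν₂ + deriv f t) * (ν₃ + deriv f t)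

/-- The second order differential equation for `H_n`, for a function `h` at the point `t`. -/
def HDiffEqAt (α γ : ℝ) (n : ℕ) (h : ℝ → ℝ) (t : ℝ) : Prop :=
  (t * deriv (deriv h) t) ^ 2 =
    (n * γ - h t - (2 * n + α + γ - t) * deriv h t) ^ 2
      - 4 * (n * (n + α + γ) - h t + t * deriv h t) * ((deriv h t) ^ 2 - γ * deriv h t)

/-- The second order difference equation for `H_n` at the point `t`, with
`hm = H_{n-1}(t)`, `h = H_n(t)`, `hp = H_{n+1}(t)`. -/
def HDifferenceEq (α γ : ℝ) (n : ℕ) (t hm h hp : ℝ) : Prop :=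
  (n * γ * t - t * h - (n * (n + α + γ) - h) * (hm - hp)) *
      ((t - n - α - γ) * γ * t - t * h - (n * (n + α + γ) + γ * t - h) * (hm - hp)) =
    (n * γ * t + n * (n + α + γ) * (2 * n + α + γ - t) - (2 * n + α + γ) * h) *
      (2 * n + α + γ - t + hm - hp) * (h - hp) * (hm - h)

/-- The discrete `σ`-form of Painlevé V at the point `t`, with
`sm = σ_{n-1}(t)`, `s = σ_n(t)`, `sp = σ_{n+1}(t)`. -/
def DiscreteSigmaFormPV (α γ : ℝ) (n : ℕ) (t sm s sp : ℝ) : Prop :=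
  (t * s - (n ^ 2 + n * α - s) * (2 * γ - sm + sp)) *
      ((2 * n + α + γ - t) * γ * t + t * s - (n ^ 2 + n * α + γ * t - s) * (2 * γ - sm + sp)) =
    (n * (n + α) * (2 * n + α + γ - t) - (2 * n + α + γ) * s) *
      (2 * n + α - γ - t + sm - sp) * (γ - s + sp) * (γ - sm + s)

end PerturbedLaguerre

end

/-!
The Hankel determinant of a positive definite moment functional `L` is the product
`h_0 ⋯ h_{n-1}` of the squared norms of its monic orthogonal polynomials `P_n`, which satisfy
`x P_n = P_{n+1} + a_n P_n + b_n P_{n-1}`. Write `p_n = -(a_0 + ⋯ + a_{n-1})` for the coefficient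
of `x^{n-1}` in `P_n`. Everything follows from two properties of `L q = ∫ q(x) w(x,t) dx`.

*Dependence on `t`.* The weight need not be differentiable in `t` when `γ ≤ 1`, but after the
substitution `x = t y` the singularity is fixed at `y = 1` and `t` only enters through a power of
`t` and `e^{-t y}`. This gives `t ∂_t L (q) = L (x q' + (α + γ + 1 - x) q)` for `t > 0`, hence
`H_n = n (n + α + γ) + p_n` (`H_eq_subCoeff`) and the Toda equations `t p_n' = p_n + b_n` and
`t b_n' = b_n (2 + a_{n-1} - a_n)`.

*Pearson equation.* The logarithmic derivative of `w` in `x` is rational with denominator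
`σ = x (x - t)`, so `L (σ q' + τ q) = 0` for a quadratic polynomial `τ`. It follows that `σ P_n'`
is a combination of `P_n` and `P_{n-1}` with coefficients of degree one (`ladder`). At `x = 0` and
`x = t` the left side vanishes, while `P_n` and `P_{n-1}` have no common zero, so the determinants
of two linear systems vanish. With `u = p_n + b_n = t H_n'`,
`X = a_n - 2n - 1 - α - γ = H_n - H_{n+1}` and `Y = H_{n-1} - H_n` this reads
`u (u - γ t) = b_n X Y` and `(n t + u) ((n + α) t + u) = b_n (t - X) (t - Y)`
(`quadratic_relations`).

The difference of these relations is linear in `u` and `b_n`, and it expresses `b_n (X + Y)` through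
them. As `t² H_n'' = b_n (Y - X)`, the identity `(Y - X)² = (X + Y)² - 4 X Y` becomes the
differential equation, while eliminating `u` and `b_n` gives the difference equation.

At `t = 0` the derivative of the moments extends continuously, because integration by parts moves
it onto the smooth factor `x^α e^{-x}`. So the slope of `H_n` at `0` is the right logarithmic
derivative of `D_n`, to which each of `h_0, …, h_{n-1}` contributes `-γ / (α + γ)`
(`hasDerivWithinAt_H_zero`).
-/

noncomputable section

namespace PerturbedLaguerre

open Polynomial Filter Topology

/-! ### Orthogonal polynomials of a positive definite functional -/

/-- The pair `(P_n, P_{n-1})` of consecutive monic orthogonal polynomials for `L`, generated by the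
three-term recurrence; `P_{-1} = 0`, so that the coefficient of `P_{-1}` is `L 1 / L 0 = 0`. -/
def opPair (L : ℝ[X] →ₗ[ℝ] ℝ) : ℕ → ℝ[X] × ℝ[X]
  | 0 => (1, 0)
  | n + 1 =>
    (X * (opPair L n).1
      - C (L (X * ((opPair L n).1 * (opPair L n).1)) / L ((opPair L n).1 * (opPair L n).1))
        * (opPair L n).1
      - C (L ((opPair L n).1 * (opPair L n).1) / L ((opPair L n).2 * (opPair L n).2))
        * (opPair L n).2, (opPair L n).1)

/-- The `n`-th monic orthogonal polynomial of the functional `L`. -/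
def op (L : ℝ[X] →ₗ[ℝ] ℝ) (n : ℕ) : ℝ[X] := (opPair L n).1

/-- The orthogonal polynomial of index `n - 1`, which is `0` for `n = 0`. -/
def opPrev (L : ℝ[X] →ₗ[ℝ] ℝ) (n : ℕ) : ℝ[X] := (opPair L n).2

/-- The squared norm `h_n = L (P_n ^ 2)`. -/
def opNorm (L : ℝ[X] →ₗ[ℝ] ℝ) (n : ℕ) : ℝ := L (op L n * op L n)

/-- The diagonal recurrence coefficient `a_n` in `x P_n = P_{n+1} + a_n P_n + b_n P_{n-1}`. -/
def recA (L : ℝ[X] →ₗ[ℝ] ℝ) (n : ℕ) : ℝ := L (X * (op L n * op L n)) / opNorm L n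

/-- The off-diagonal recurrence coefficient `b_n = h_n / h_{n-1}`, with `b_0 = 0`. -/
def recB (L : ℝ[X] →ₗ[ℝ] ℝ) (n : ℕ) : ℝ := opNorm L n / L (opPrev L n * opPrev L n)

/-- The coefficient of `x^{n-1}` in `P_n`, written as `p_n = -(a_0 + ⋯ + a_{n-1})`. -/
def subCoeff (L : ℝ[X] →ₗ[ℝ] ℝ) (n : ℕ) : ℝ := -∑ j ∈ Finset.range n, recA L j

section Orthogonality

variable {L : ℝ[X] →ₗ[ℝ] ℝ}

@[simp] lemma op_zero : op L 0 = 1 := rfl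

@[simp] lemma opPrev_zero : opPrev L 0 = 0 := rfl

@[simp] lemma opPrev_succ (n : ℕ) : opPrev L (n + 1) = op L n := rfl

lemma op_succ (n : ℕ) :
    op L (n + 1) = X * op L n - C (recA L n) * op L n - C (recB L n) * opPrev L n := rfl

@[simp] lemma recB_zero : recB L 0 = 0 := by simp [recB]

lemma recB_succ (n : ℕ) : recB L (n + 1) = opNorm L (n + 1) / opNorm L n := rfl

@[simp] lemma subCoeff_zero : subCoeff L 0 = 0 := by simp [subCoeff]

lemma subCoeff_succ (n : ℕ) : subCoeff L (n + 1) = subCoeff L n - recA L n := by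
  simp [subCoeff, Finset.sum_range_succ]; ring

lemma functional_C_mul (c : ℝ) (q : ℝ[X]) : L (C c * q) = c * L q := by
  rw [← smul_eq_C_mul, map_smul, smul_eq_mul]

lemma degree_lt_succ_of_coeff {q : ℝ[X]} {n : ℕ} (hq : q.degree < ((n + 1 : ℕ) : WithBot ℕ))
    (h : q.coeff n = 0) : q.degree < (n : WithBot ℕ) := by
  rw [degree_lt_iff_coeff_zero] at hq ⊢
  intro m hm
  rcases hm.eq_or_lt with rfl | h'
  · exact h
  · exact hq m h'

lemma degree_X_mul_lt {q : ℝ[X]} {n : ℕ} (hq : q.degree < (n : WithBot ℕ)) :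
    (X * q).degree < ((n + 1 : ℕ) : WithBot ℕ) := by
  rw [degree_lt_iff_coeff_zero] at hq ⊢
  rintro (_ | m) hm
  · omega
  · rw [coeff_X_mul]; exact hq m (by omega)

lemma degree_C_mul_lt {q : ℝ[X]} {n : ℕ} (c : ℝ) (hq : q.degree < (n : WithBot ℕ)) :
    (C c * q).degree < (n : WithBot ℕ) := by
  rw [degree_lt_iff_coeff_zero] at hq ⊢
  intro m hm
  rw [coeff_C_mul, hq m hm, mul_zero]

lemma degree_sub_lt' {p q : ℝ[X]} {n : ℕ} (hp : p.degree < (n : WithBot ℕ))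
    (hq : q.degree < (n : WithBot ℕ)) : (p - q).degree < (n : WithBot ℕ) := by
  rw [degree_lt_iff_coeff_zero] at hp hq ⊢
  intro m hm
  rw [coeff_sub, hp m hm, hq m hm, sub_zero]

lemma degree_add_lt' {p q : ℝ[X]} {n : ℕ} (hp : p.degree < (n : WithBot ℕ))
    (hq : q.degree < (n : WithBot ℕ)) : (p + q).degree < (n : WithBot ℕ) := by
  rw [degree_lt_iff_coeff_zero] at hp hq ⊢
  intro m hm
  rw [coeff_add, hp m hm, hq m hm, add_zero]

lemma degree_lt_mono {p : ℝ[X]} {n m : ℕ} (hp : p.degree < (n : WithBot ℕ)) (h : n ≤ m) :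
    p.degree < (m : WithBot ℕ) := hp.trans_le (by exact_mod_cast h)

lemma degree_opPair_lt (n : ℕ) : (op L n).degree < ((n + 1 : ℕ) : WithBot ℕ) ∧
    (opPrev L n).degree < (n : WithBot ℕ) := by
  induction n with
  | zero => simp
  | succ n ih =>
    refine ⟨?_, by simpa using ih.1⟩
    rw [op_succ]
    exact degree_sub_lt' (degree_sub_lt' (degree_X_mul_lt ih.1)
      (degree_C_mul_lt _ (degree_lt_mono ih.1 (by omega))))
      (degree_C_mul_lt _ (degree_lt_mono ih.2 (by omega)))

lemma degree_op_lt (n : ℕ) : (op L n).degree < ((n + 1 : ℕ) : WithBot ℕ) :=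
  (degree_opPair_lt n).1

lemma degree_opPrev_lt (n : ℕ) : (opPrev L n).degree < (n : WithBot ℕ) := (degree_opPair_lt n).2

lemma coeff_of_degree_lt {q : ℝ[X]} {n m : ℕ} (hq : q.degree < (n : WithBot ℕ)) (h : n ≤ m) :
    q.coeff m = 0 := (degree_lt_iff_coeff_zero q n).1 hq m h

@[simp] lemma coeff_op_self (n : ℕ) : (op L n).coeff n = 1 := by
  induction n with
  | zero => simp
  | succ n ih =>
    rw [op_succ, coeff_sub, coeff_sub, coeff_X_mul, coeff_C_mul, coeff_C_mul, ih,
      coeff_of_degree_lt (degree_op_lt n) le_rfl,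
      coeff_of_degree_lt (degree_opPrev_lt n) (by omega : n ≤ n + 1)]
    ring

lemma coeff_op_succ (n : ℕ) : (op L (n + 1)).coeff n = subCoeff L (n + 1) := by
  induction n with
  | zero => rw [op_succ, subCoeff_succ]; simp
  | succ n ih =>
    rw [op_succ, coeff_sub, coeff_sub, coeff_X_mul, coeff_C_mul, coeff_C_mul, ih,
      coeff_of_degree_lt (degree_opPrev_lt (n + 1)) le_rfl, coeff_op_self, subCoeff_succ (n + 1)]
    ring

lemma op_ne_zero (n : ℕ) : op L n ≠ 0 := fun h => by simpa [h] using coeff_op_self (L := L) n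

/-- Removing the leading term with a multiple of `P_n`. -/
lemma degree_sub_leading {q : ℝ[X]} {n : ℕ} (hq : q.degree < ((n + 1 : ℕ) : WithBot ℕ)) :
    (q - C (q.coeff n) * op L n).degree < (n : WithBot ℕ) :=
  degree_lt_succ_of_coeff (degree_sub_lt' hq (degree_C_mul_lt _ (degree_op_lt n))) (by simp)

variable (hL : ∀ q : ℝ[X], q ≠ 0 → 0 < L (q * q))
include hL

lemma opNorm_pos (n : ℕ) : 0 < opNorm L n := hL _ (op_ne_zero n)

lemma recB_pos (n : ℕ) : 0 < recB L (n + 1) := div_pos (opNorm_pos hL _) (opNorm_pos hL _)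

lemma recB_mul_opNorm (n : ℕ) : recB L (n + 1) * opNorm L n = opNorm L (n + 1) := by
  rw [recB_succ, div_mul_cancel₀ _ (opNorm_pos hL n).ne']

lemma functional_X_op_sq (n : ℕ) : L (X * (op L n * op L n)) = recA L n * opNorm L n := by
  rw [recA, div_mul_cancel₀ _ (opNorm_pos hL n).ne']

omit hL in
lemma functional_op_succ_mul (n : ℕ) (q : ℝ[X]) : L (op L (n + 1) * q) =
    L (op L n * (X * q)) - recA L n * L (op L n * q) - recB L n * L (opPrev L n * q) := by
  rw [← functional_C_mul, ← functional_C_mul, ← map_sub, ← map_sub, op_succ]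
  congr 1; ring

/-- Orthogonality: the polynomials produced by the recurrence annihilate all lower degrees. -/
lemma functional_op_mul_eq_zero (n : ℕ) :
    ∀ q : ℝ[X], q.degree < (n : WithBot ℕ) → L (op L n * q) = 0 := by
  induction n using Nat.strong_induction_on with
  | _ n ih =>
    intro q hq
    rcases n with _ | n
    · have : q = 0 := by
        rw [Nat.cast_zero] at hq
        exact Polynomial.degree_eq_bot.1 (by simpa using hq)
      simp [this]
    -- It suffices to test against `P_n` and against lower degrees.
    have main : L (op L (n + 1) * op L n) = 0 ∧
        ∀ q : ℝ[X], q.degree < (n : WithBot ℕ) → L (op L (n + 1) * q) = 0 := by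
      have hX : op L n * (X * op L n) = X * (op L n * op L n) := by ring
      rcases n with _ | m
      · refine ⟨?_, fun q hq => ?_⟩
        · rw [functional_op_succ_mul, hX, functional_X_op_sq hL]
          simp [opNorm]
        · have : q = 0 := by
            rw [Nat.cast_zero] at hq
            exact Polynomial.degree_eq_bot.1 (by simpa using hq)
          simp [this]
      have h1 := ih (m + 1) (by omega)
      have h0 := ih m (by omega)
      refine ⟨?_, fun q hq => ?_⟩
      · rw [functional_op_succ_mul, hX, functional_X_op_sq hL, opPrev_succ, mul_comm (op L m),
          h1 _ (degree_op_lt m)]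
        simp [opNorm]
      -- Lower degrees are reduced to `P_m` and to degrees below `m`.
      have hq' := degree_sub_leading (L := L) hq
      set q' := q - C (q.coeff m) * op L m with hq'_def
      have hsplit : op L (m + 1 + 1) * q = C (q.coeff m) * (op L (m + 1 + 1) * op L m)
          + op L (m + 1 + 1) * q' := by rw [hq'_def]; ring
      have e1 : L (op L (m + 1 + 1) * op L m) = 0 := by
        have h2 : L (op L (m + 1) * (X * op L m)) = opNorm L (m + 1) := by
          have : op L (m + 1) * (X * op L m) = op L (m + 1) * op L (m + 1)
              + op L (m + 1) * (X * op L m - op L (m + 1)) := by ring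
          rw [this, map_add, h1 (X * op L m - op L (m + 1)) ?_, add_zero, opNorm]
          refine degree_lt_succ_of_coeff
            (degree_sub_lt' (degree_X_mul_lt (degree_op_lt m)) (degree_op_lt (m + 1))) ?_
          simp [coeff_X_mul]
        rw [functional_op_succ_mul, h2, h1 _ (degree_op_lt m), opPrev_succ, mul_zero, sub_zero]
        rw [← recB_mul_opNorm hL m, opNorm, sub_self]
      have e2 : L (op L (m + 1 + 1) * q') = 0 := by
        rw [functional_op_succ_mul, h1 _ (degree_X_mul_lt hq'),
          h1 _ (degree_lt_mono hq' (by omega)), opPrev_succ, h0 _ hq']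
        ring
      rw [hsplit, map_add, functional_C_mul, e1, e2]
      ring
    have hq' := degree_sub_leading (L := L) hq
    set q' := q - C (q.coeff n) * op L n with hq'_def
    have hsplit : op L (n + 1) * q = C (q.coeff n) * (op L (n + 1) * op L n)
        + op L (n + 1) * q' := by rw [hq'_def]; ring
    rw [hsplit, map_add, functional_C_mul, main.1, main.2 _ hq']
    ring

/-- `L (P_n q)` for `deg q ≤ n` only sees the leading coefficient of `q`. -/
lemma functional_op_mul {n : ℕ} {q : ℝ[X]} (hq : q.degree < ((n + 1 : ℕ) : WithBot ℕ)) :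
    L (op L n * q) = q.coeff n * opNorm L n := by
  have h := functional_op_mul_eq_zero hL n _ (degree_sub_leading (L := L) hq)
  have hsplit : op L n * q = C (q.coeff n) * (op L n * op L n)
      + op L n * (q - C (q.coeff n) * op L n) := by ring
  rw [hsplit, map_add, functional_C_mul, h, add_zero, opNorm]

/-- `L (P_n q)` for `deg q ≤ n + 1` in terms of the two leading coefficients of `q`. -/
lemma functional_op_mul_succ {n : ℕ} {q : ℝ[X]} (hq : q.degree < ((n + 2 : ℕ) : WithBot ℕ)) :
    L (op L n * q) = (q.coeff n - subCoeff L (n + 1) * q.coeff (n + 1)) * opNorm L n := by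
  have h := functional_op_mul hL (degree_sub_leading (L := L) (n := n + 1) hq)
  have h2 := functional_op_mul_eq_zero hL (n + 1) (op L n) (degree_op_lt n)
  have hsplit : op L n * q = C (q.coeff (n + 1)) * (op L (n + 1) * op L n)
      + op L n * (q - C (q.coeff (n + 1)) * op L (n + 1)) := by ring
  rw [hsplit, map_add, functional_C_mul, h, h2, coeff_sub, coeff_C_mul, coeff_op_succ]
  ring

lemma functional_op_mul_op_of_ne {i j : ℕ} (hij : i ≠ j) : L (op L i * op L j) = 0 := by
  rcases lt_or_gt_of_ne hij with h | h
  · rw [mul_comm]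
    exact functional_op_mul_eq_zero hL j _ (degree_lt_mono (degree_op_lt i) h)
  · exact functional_op_mul_eq_zero hL i _ (degree_lt_mono (degree_op_lt j) h)

/-- The pairings of `P_n` and `b_n P_{n-1}` with `x P_n`. The factor `b_n` makes the second one
valid for `n = 0` too. -/
lemma recB_mul_functional_prev_X (n : ℕ) :
    L (op L n * (X * op L n)) = recA L n * opNorm L n ∧
    recB L n * L (opPrev L n * (X * op L n)) = recB L n * opNorm L n := by
  constructor
  · rw [← functional_X_op_sq hL]; congr 1; ring
  · rcases n with _ | m
    · simp
    · congr 1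
      have : opPrev L (m + 1) * (X * op L (m + 1)) = op L (m + 1) * (X * op L m) := by
        rw [opPrev_succ]; ring
      rw [this, functional_op_mul hL (degree_X_mul_lt (degree_op_lt m)), coeff_X_mul,
        coeff_op_self, one_mul]

lemma eq_zero_of_functional_mul_eq_zero {q : ℝ[X]} {n : ℕ} (hq : q.degree < (n : WithBot ℕ))
    (h : ∀ s : ℝ[X], s.degree < (n : WithBot ℕ) → L (q * s) = 0) : q = 0 := by
  by_contra h0
  exact (hL q h0).ne' (h q hq)

/-- Consecutive orthogonal polynomials have no common zero. -/
lemma op_eval_ne_zero_or (n : ℕ) (c : ℝ) : (op L n).eval c ≠ 0 ∨ (opPrev L n).eval c ≠ 0 := by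
  induction n with
  | zero => simp
  | succ n ih =>
    by_contra! h
    rw [opPrev_succ] at h
    obtain ⟨h1, h2⟩ := h
    rcases n with _ | m
    · simp at h2
    rw [op_succ] at h1
    simp only [eval_sub, eval_mul, eval_C, eval_X, h2, mul_zero, zero_sub, neg_eq_zero,
      mul_eq_zero, sub_zero] at h1
    rcases h1 with h1 | h1
    · exact (recB_pos hL m).ne' h1
    · rcases ih with ih | ih
      · exact ih h2
      · exact ih h1

/-- The Hankel determinant of the moments is the product of the norms `h_0, …, h_{n-1}`. -/
lemma det_moments_eq_prod (n : ℕ) :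
    Matrix.det (Matrix.of fun i j : Fin n => L (X ^ ((i : ℕ) + (j : ℕ))))
      = ∏ j ∈ Finset.range n, opNorm L j := by
  set U : Matrix (Fin n) (Fin n) ℝ := Matrix.of fun i j => (op L i).coeff j with hU
  set M : Matrix (Fin n) (Fin n) ℝ := Matrix.of fun i j => L (X ^ ((i : ℕ) + (j : ℕ))) with hM
  have hdetU : U.det = 1 := by
    rw [Matrix.det_of_isLowerTriangular]
    · simp [hU]
    · intro i j hij
      have : (i : ℕ) < j := by simpa using hij
      simpa [hU] using coeff_of_degree_lt (degree_op_lt (L := L) i) (by omega)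
  have hprod : U * M * U.transpose = Matrix.diagonal fun i : Fin n => opNorm L i := by
    have hexp : ∀ i : Fin n, op L i = ∑ k : Fin n, C ((op L i).coeff k) * X ^ (k : ℕ) := by
      intro i
      rw [Fin.sum_univ_eq_sum_range (fun k => C ((op L i).coeff k) * X ^ k) n]
      refine as_sum_range_C_mul_X_pow' _ ?_
      have := degree_op_lt (L := L) i
      rw [natDegree_lt_iff_degree_lt (op_ne_zero _)]
      exact degree_lt_mono this i.2
    ext i j
    have hval : (U * M * U.transpose) i j = L (op L i * op L j) := by
      conv_rhs => rw [hexp i, hexp j, Finset.sum_mul_sum]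
      simp only [Matrix.mul_apply, map_sum, Matrix.transpose_apply, Finset.sum_mul]
      rw [Finset.sum_comm]
      refine Finset.sum_congr rfl fun k _ => Finset.sum_congr rfl fun l _ => ?_
      have : C ((op L i).coeff k) * X ^ (k : ℕ) * (C ((op L j).coeff l) * X ^ (l : ℕ))
          = C ((op L i).coeff k * (op L j).coeff l) * X ^ ((k : ℕ) + l) := by
        rw [C_mul, pow_add]; ring
      rw [this, functional_C_mul]
      simp only [hU, hM, Matrix.of_apply]
      ring
    rw [hval, Matrix.diagonal_apply]
    split_ifs with h
    · rw [h, opNorm]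
    · exact functional_op_mul_op_of_ne hL fun h' => h (Fin.ext h')
  have := congrArg Matrix.det hprod
  rw [Matrix.det_mul, Matrix.det_mul, Matrix.det_transpose, hdetU, one_mul, mul_one,
    Matrix.det_diagonal] at this
  rw [this, Finset.prod_range]

end Orthogonality

/-! ### The Pearson equation and the ladder relation -/

/-- The Pearson equation of the weight `x^α e^{-x} |x - t|^γ (A + B θ(x - t))`, written as a
property of the moment functional `L`: with `σ = x (x - t)` and `τ = (σ w)' / w`, the total derivative
`(σ q w)' = (σ q' + τ q) w` has integral `0`. -/
def IsPearson (α γ t : ℝ) (L : ℝ[X] →ₗ[ℝ] ℝ) : Prop :=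
  ∀ q : ℝ[X], L (X * (X - C t) * derivative q
    + (C (α + 1) * (X - C t) + C (γ + 1) * X - X * (X - C t)) * q) = 0

lemma coeff_X_mul_derivative (q : ℝ[X]) (k : ℕ) :
    (X * derivative q).coeff k = k * q.coeff k := by
  rcases k with _ | k
  · simp
  · rw [coeff_X_mul, coeff_derivative]; push_cast; ring

lemma degree_X_mul_derivative_lt {q : ℝ[X]} {n : ℕ} (hq : q.degree < (n : WithBot ℕ)) :
    (X * derivative q).degree < (n : WithBot ℕ) := by
  rw [degree_lt_iff_coeff_zero] at hq ⊢
  intro m hm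
  rw [coeff_X_mul_derivative, hq m hm, mul_zero]

section Pearson

variable {L : ℝ[X] →ₗ[ℝ] ℝ} {α γ t : ℝ}

/-- The expansion of `x (x - t) P_n'` in `P_n` and `P_{n-1}` with linear coefficients. -/
lemma ladder (hL : ∀ q : ℝ[X], q ≠ 0 → 0 < L (q * q)) (hP : IsPearson α γ t L) (n : ℕ) :
    X * (X - C t) * derivative (op L n) =
      C (recB L n) * (X - C (t + 2 * n + 1 + α + γ - recA L n)) * opPrev L n
        + (C (n : ℝ) * X - C (t * n + subCoeff L n + recB L n)) * op L n := by
  rcases n with _ | m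
  · simp
  set P := op L (m + 1) with hPdef
  set Q := op L m with hQdef
  set b := recB L (m + 1) with hb
  set κ := t + 2 * ((m + 1 : ℕ) : ℝ) + 1 + α + γ - recA L (m + 1) with hκ
  set e := t * ((m + 1 : ℕ) : ℝ) + subCoeff L (m + 1) + b with he
  rw [opPrev_succ, ← sub_eq_zero]
  have hdP : P.degree < ((m + 2 : ℕ) : WithBot ℕ) := degree_op_lt (m + 1)
  have hdQ : Q.degree < ((m + 1 : ℕ) : WithBot ℕ) := degree_op_lt m
  -- The difference of both sides has degree at most `m` and is orthogonal to all such degrees.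
  refine eq_zero_of_functional_mul_eq_zero hL (n := m + 1) ?_ fun s hs => ?_
  · set G := X * derivative P with hG
    have hE : X * (X - C t) * derivative P - (C b * (X - C κ) * Q
        + (C ((m + 1 : ℕ) : ℝ) * X - C e) * P) =
        X * G - C t * G - C b * (X * Q) + C (b * κ) * Q
        - C ((m + 1 : ℕ) : ℝ) * (X * P) + C e * P := by
      rw [C_mul, hG]; ring
    rw [hE]
    refine degree_lt_succ_of_coeff (degree_lt_succ_of_coeff ?_ ?_) ?_
    · have hdX : G.degree < ((m + 2 : ℕ) : WithBot ℕ) := degree_X_mul_derivative_lt hdP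
      refine degree_add_lt' (degree_sub_lt' (degree_add_lt' (degree_sub_lt' (degree_sub_lt'
        (degree_X_mul_lt hdX) (degree_C_mul_lt _ (degree_lt_mono hdX (by omega))))
        (degree_C_mul_lt _ (degree_lt_mono (degree_X_mul_lt hdQ) (by omega))))
        (degree_C_mul_lt _ (degree_lt_mono hdQ (by omega))))
        (degree_C_mul_lt _ (degree_X_mul_lt hdP)))
        (degree_C_mul_lt _ (degree_lt_mono hdP (by omega)))
    · simp only [coeff_add, coeff_sub, coeff_C_mul, coeff_X_mul]
      rw [hG, coeff_X_mul_derivative, coeff_X_mul_derivative, hPdef, coeff_op_self,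
        ← hPdef, coeff_of_degree_lt hdP le_rfl,
        coeff_of_degree_lt hdQ le_rfl, coeff_of_degree_lt hdQ (by omega : m + 1 ≤ m + 1 + 1)]
      ring
    · simp only [coeff_add, coeff_sub, coeff_C_mul, coeff_X_mul]
      rw [hG, coeff_X_mul_derivative, coeff_X_mul_derivative, hPdef, coeff_op_self,
        coeff_op_succ, hQdef, coeff_op_self, ← hQdef,
        coeff_of_degree_lt hdQ le_rfl, he]
      push_cast
      ring
  · set D := X * derivative s with hD
    have hdD : D.degree < ((m + 1 : ℕ) : WithBot ℕ) := degree_X_mul_derivative_lt hs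
    set W := X * D - C t * D + C (α + γ + 2 + t) * (X * s) - C ((α + 1) * t) * s
      - X * (X * s) with hW
    have hdXs := degree_X_mul_lt hs
    have hdW : W.degree < ((m + 1 + 2 : ℕ) : WithBot ℕ) :=
      degree_sub_lt' (degree_sub_lt' (degree_add_lt' (degree_sub_lt'
        (degree_lt_mono (degree_X_mul_lt hdD) (by omega))
        (degree_C_mul_lt _ (degree_lt_mono hdD (by omega))))
        (degree_C_mul_lt _ (degree_lt_mono hdXs (by omega))))
        (degree_C_mul_lt _ (degree_lt_mono hs (by omega)))) (degree_X_mul_lt hdXs)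
    have hs1 : s.coeff (m + 1) = 0 := coeff_of_degree_lt hs le_rfl
    have hW1 : W.coeff (m + 1) = (m + α + γ + 2 + t) * s.coeff m - (X * s).coeff m := by
      rw [hW]
      simp only [coeff_add, coeff_sub, coeff_C_mul, coeff_X_mul]
      rw [hD, coeff_X_mul_derivative, coeff_X_mul_derivative, hs1]
      ring
    have hW2 : W.coeff (m + 1 + 1) = -s.coeff m := by
      rw [hW]
      simp only [coeff_add, coeff_sub, coeff_C_mul, coeff_X_mul]
      rw [hD, coeff_X_mul_derivative, coeff_X_mul_derivative, hs1,
        coeff_of_degree_lt hs (by omega : m + 1 ≤ m + 1 + 1)]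
      ring
    have hPW : L (X * (X - C t) * derivative P * s) = -L (P * W) := by
      have h := hP (P * s)
      rw [derivative_mul] at h
      have hsum : X * (X - C t) * derivative P * s + P * W =
          X * (X - C t) * (derivative P * s + P * derivative s)
          + (C (α + 1) * (X - C t) + C (γ + 1) * X - X * (X - C t)) * (P * s) := by
        rw [hW, hD]
        simp only [C_add, C_mul, C_1, map_ofNat]
        ring
      rw [eq_neg_iff_add_eq_zero, ← map_add, hsum, h]
    have h1 := functional_op_mul_succ hL hdW
    have h2 := functional_op_mul hL (n := m + 1) hdXs
    have h3 := functional_op_mul_eq_zero hL (m + 1) s hs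
    have h4 : L (Q * ((X - C κ) * s)) = ((X * s).coeff m - κ * s.coeff m
        - subCoeff L (m + 1) * s.coeff m) * opNorm L m := by
      have hd : (X * s - C κ * s).degree < ((m + 2 : ℕ) : WithBot ℕ) :=
        degree_sub_lt' hdXs (degree_C_mul_lt _ (degree_lt_mono hs (by omega)))
      have := functional_op_mul_succ hL hd
      rw [sub_mul, this]
      simp only [coeff_sub, coeff_C_mul, coeff_X_mul]
      rw [hs1]; ring
    have hsplit : (X * (X - C t) * derivative P - (C b * (X - C κ) * Q
        + (C ((m + 1 : ℕ) : ℝ) * X - C e) * P)) * s = X * (X - C t) * derivative P * s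
        - C b * (Q * ((X - C κ) * s)) - C ((m + 1 : ℕ) : ℝ) * (P * (X * s)) + C e * (P * s) := by
      ring
    rw [hsplit, map_add, map_sub, map_sub, hPW, functional_C_mul, functional_C_mul,
      functional_C_mul, h1, h2, h3, h4, hW1, hW2, coeff_X_mul, ← recB_mul_opNorm hL m,
      subCoeff_succ (m + 1), hκ]
    push_cast
    ring

/-- The Laguerre–Freud equation, from the Pearson equation for `P_n ^ 2`. -/
lemma laguerre_freud (hL : ∀ q : ℝ[X], q ≠ 0 → 0 < L (q * q)) (hP : IsPearson α γ t L) (n : ℕ) :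
    recA L n * (2 * n + α + γ + 2 + t - recA L n) =
      (2 * n + α + 1) * t + 2 * subCoeff L n + recB L (n + 1) + recB L n := by
  set P := op L n with hPdef
  set Q := opPrev L n with hQdef
  have hh := opNorm_pos hL n
  obtain ⟨h1, h2⟩ := recB_mul_functional_prev_X hL n
  rw [← hPdef] at h1 h2
  rw [← hQdef] at h2
  have hQP : recB L n * L (Q * P) = 0 := by
    rcases n with _ | m
    · simp
    · rw [hQdef, opPrev_succ, mul_comm (op L m), functional_op_mul_eq_zero hL _ _ (degree_op_lt m),
        mul_zero]
  have hPP : L (P * P) = opNorm L n := rfl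
  have hXX : L ((X * P) * (X * P)) = (recB L (n + 1) + recA L n ^ 2 + recB L n) * opNorm L n := by
    have hsplit : (X * P) * (X * P) = op L (n + 1) * (X * P) + C (recA L n) * (P * (X * P))
        + C (recB L n) * (Q * (X * P)) := by
      rw [op_succ, ← hPdef, ← hQdef]; ring
    rw [hsplit, map_add, map_add, functional_C_mul, functional_C_mul, h1, h2,
      functional_op_mul hL (degree_X_mul_lt (degree_op_lt n)), coeff_X_mul, coeff_op_self,
      ← recB_mul_opNorm hL n]
    ring
  have h := hP (P * P)
  have hsplit : X * (X - C t) * derivative (P * P)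
      + (C (α + 1) * (X - C t) + C (γ + 1) * X - X * (X - C t)) * (P * P) =
      C 2 * (C (recB L n) * (Q * (X * P))) - C (2 * (t + 2 * n + 1 + α + γ - recA L n)) *
        (C (recB L n) * (Q * P)) + C (2 * n + α + γ + 2 + t) * (P * (X * P))
      - C (2 * (t * n + subCoeff L n + recB L n) + (α + 1) * t) * (P * P) - X * P * (X * P) := by
    have hl := ladder hL hP n
    rw [← hPdef, ← hQdef] at hl
    have : X * (X - C t) * derivative (P * P) = 2 * (X * (X - C t) * derivative P) * P := by
      rw [derivative_mul]; ring
    rw [this, hl]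
    simp only [C_add, C_mul, C_sub, C_1, map_ofNat]
    ring
  rw [hsplit] at h
  rw [map_sub, map_sub, map_add, map_sub, functional_C_mul, functional_C_mul, functional_C_mul,
    functional_C_mul, functional_C_mul, functional_C_mul, h1, h2, hQP, hPP, hXX] at h
  have h' : (recA L n * (2 * n + α + γ + 2 + t - recA L n) - ((2 * n + α + 1) * t
      + 2 * subCoeff L n + recB L (n + 1) + recB L n)) * opNorm L n = 0 := by linarith
  rcases mul_eq_zero.1 h' with h' | h'
  · linarith
  · exact absurd h' hh.ne'

/-- The ladder relation is evaluated at a zero `c` of `x (x - t)`, where its left side vanishes.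
Since `P_{m+1}` and `P_m` have no common zero, the determinant of the resulting linear system
vanishes. -/
lemma ladder_det (hL : ∀ q : ℝ[X], q ≠ 0 → 0 < L (q * q)) (hP : IsPearson α γ t L) (m : ℕ) {c : ℝ}
    (hc : c * (c - t) = 0) :
    recB L (m + 1) * (c - (t + 2 * ((m + 1 : ℕ) : ℝ) + 1 + α + γ - recA L (m + 1)))
        * (c - (t + 2 * m + 1 + α + γ - recA L m))
      + (((m + 1 : ℕ) : ℝ) * c - (t * ((m + 1 : ℕ) : ℝ) + subCoeff L (m + 1) + recB L (m + 1)))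
        * ((c - (t + 2 * m + 1 + α + γ - recA L m)) * (c - recA L m) + m * c
          - (t * m + subCoeff L m + recB L m)) = 0 := by
  have e1 := congrArg (eval c) (ladder hL hP (m + 1))
  have e2 := congrArg (eval c) (ladder hL hP m)
  have e3 := congrArg (eval c) (op_succ (L := L) m)
  simp only [eval_mul, eval_X, eval_sub, eval_C, hc, zero_mul, eval_add, opPrev_succ] at e1 e2 e3
  have hne := op_eval_ne_zero_or hL (m + 1) c
  rw [opPrev_succ] at hne
  set p := eval c (op L (m + 1))
  set q := eval c (op L m)
  set u := c - (t + 2 * (m : ℝ) + 1 + α + γ - recA L m)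
  set v := c - (t + 2 * ((m + 1 : ℕ) : ℝ) + 1 + α + γ - recA L (m + 1))
  set w := ((m + 1 : ℕ) : ℝ) * c - (t * ((m + 1 : ℕ) : ℝ) + subCoeff L (m + 1) + recB L (m + 1))
  have e2' : (u * (c - recA L m) + m * c - (t * m + subCoeff L m + recB L m)) * q - u * p = 0 := by
    linear_combination (-1) * e2 - u * e3
  rcases hne with hp | hq
  · refine (mul_eq_zero.1 ?_).resolve_right hp
    linear_combination -(u * (c - recA L m) + m * c - (t * m + subCoeff L m + recB L m)) * e1
      - recB L (m + 1) * v * e2'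
  · refine (mul_eq_zero.1 ?_).resolve_right hq
    linear_combination -u * e1 + w * e2'

/-- The two quadratic relations between the recurrence coefficients, at `x = t` and `x = 0`. -/
lemma quadratic_relations (hL : ∀ q : ℝ[X], q ≠ 0 → 0 < L (q * q)) (hP : IsPearson α γ t L)
    (m : ℕ) :
    (subCoeff L (m + 1) + recB L (m + 1)) * (subCoeff L (m + 1) + recB L (m + 1) - γ * t) =
      recB L (m + 1) * (recA L (m + 1) - 2 * (m + 1) - 1 - α - γ)
        * (recA L m - 2 * m - 1 - α - γ) ∧
    (t * (m + 1) + subCoeff L (m + 1) + recB L (m + 1))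
        * (t * (m + 1 + α) + subCoeff L (m + 1) + recB L (m + 1)) =
      recB L (m + 1) * (t - (recA L (m + 1) - 2 * (m + 1) - 1 - α - γ))
        * (t - (recA L m - 2 * m - 1 - α - γ)) := by
  have hlf := laguerre_freud hL hP m
  have hp := subCoeff_succ (L := L) m
  have d1 := ladder_det hL hP m (c := t) (by ring)
  have d0 := ladder_det hL hP m (c := 0) (by ring)
  push_cast at d1 d0
  constructor
  · linear_combination (-1) * d1 + (-1) * (subCoeff L (m + 1) + recB L (m + 1)) * (hlf - hp)
  · linear_combination (-1) * d0
      + (-1) * (t * (m + 1) + subCoeff L (m + 1) + recB L (m + 1)) * (hlf - hp)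

end Pearson

/-! ### Orthogonal polynomials depending on a parameter -/

/-- The linear functional on polynomials with moments `μ k = L (x^k)`. -/
def momentFunctional (μ : ℕ → ℝ) : ℝ[X] →ₗ[ℝ] ℝ :=
  Polynomial.lsum fun k => LinearMap.toSpanSingleton ℝ ℝ (μ k)

lemma momentFunctional_eq_sum (μ : ℕ → ℝ) {q : ℝ[X]} {N : ℕ} (hq : q.degree < (N : WithBot ℕ)) :
    momentFunctional μ q = ∑ k ∈ Finset.range N, q.coeff k * μ k := by
  have : momentFunctional μ q = q.sum fun k c => c * μ k := by
    simp [momentFunctional, Polynomial.lsum_apply]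
  rw [this]
  by_cases h0 : q = 0
  · simp [h0]
  · exact sum_over_range' _ (by simp) _ ((natDegree_lt_iff_degree_lt h0).2 hq)

@[simp] lemma momentFunctional_X_pow (μ : ℕ → ℝ) (k : ℕ) : momentFunctional μ (X ^ k) = μ k := by
  rw [momentFunctional_eq_sum μ (N := k + 1) ((degree_X_pow_le k).trans_lt (by
    exact_mod_cast Nat.lt_succ_self k))]
  simp [coeff_X_pow]

/-- Coefficientwise differentiability of a family of polynomials of bounded degree. -/
def HasPolyDerivWithinAt (q : ℝ → ℝ[X]) (q' : ℝ[X]) (S : Set ℝ) (t : ℝ) : Prop :=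
  (∃ N : ℕ, (∀ s, (q s).degree < (N : WithBot ℕ)) ∧ q'.degree < (N : WithBot ℕ)) ∧
    ∀ k, HasDerivWithinAt (fun s => (q s).coeff k) (q'.coeff k) S t

section Parameter

variable {q₁ q₂ : ℝ → ℝ[X]} {q₁' q₂' : ℝ[X]} {S : Set ℝ} {t : ℝ}

lemma hasPolyDerivWithinAt_const (q : ℝ[X]) : HasPolyDerivWithinAt (fun _ => q) 0 S t := by
  refine ⟨⟨q.natDegree + 1, fun _ => ?_, by simp⟩, fun k => by
    simpa using hasDerivWithinAt_const _ _ _⟩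
  exact degree_le_natDegree.trans_lt (by exact_mod_cast Nat.lt_succ_self _)

lemma HasPolyDerivWithinAt.sub (h₁ : HasPolyDerivWithinAt q₁ q₁' S t)
    (h₂ : HasPolyDerivWithinAt q₂ q₂' S t) :
    HasPolyDerivWithinAt (fun s => q₁ s - q₂ s) (q₁' - q₂') S t := by
  obtain ⟨⟨N₁, b₁, b₁'⟩, d₁⟩ := h₁
  obtain ⟨⟨N₂, b₂, b₂'⟩, d₂⟩ := h₂
  have l₁ := le_max_left N₁ N₂
  have l₂ := le_max_right N₁ N₂
  refine ⟨⟨max N₁ N₂, fun s => ?_, ?_⟩, fun k => ?_⟩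
  · exact degree_sub_lt' (degree_lt_mono (b₁ s) l₁) (degree_lt_mono (b₂ s) l₂)
  · exact degree_sub_lt' (degree_lt_mono b₁' l₁) (degree_lt_mono b₂' l₂)
  · simpa only [coeff_sub] using (d₁ k).fun_sub (d₂ k)

lemma HasPolyDerivWithinAt.mul (h₁ : HasPolyDerivWithinAt q₁ q₁' S t)
    (h₂ : HasPolyDerivWithinAt q₂ q₂' S t) :
    HasPolyDerivWithinAt (fun s => q₁ s * q₂ s) (q₁' * q₂ t + q₁ t * q₂') S t := by
  obtain ⟨⟨N₁, b₁, b₁'⟩, d₁⟩ := h₁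
  obtain ⟨⟨N₂, b₂, b₂'⟩, d₂⟩ := h₂
  have hmul : ∀ {p q : ℝ[X]}, p.degree < (N₁ : WithBot ℕ) → q.degree < (N₂ : WithBot ℕ) →
      (p * q).degree < ((N₁ + N₂ : ℕ) : WithBot ℕ) := by
    intro p q hp hq
    rw [degree_lt_iff_coeff_zero]
    intro m hm
    rw [coeff_mul]
    refine Finset.sum_eq_zero fun x hx => ?_
    have hx' := Finset.HasAntidiagonal.mem_antidiagonal.1 hx
    rcases le_or_gt N₁ x.1 with h | h
    · rw [coeff_of_degree_lt hp h, zero_mul]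
    · rw [coeff_of_degree_lt hq (by omega), mul_zero]
  refine ⟨⟨N₁ + N₂, fun s => hmul (b₁ s) (b₂ s), ?_⟩, fun k => ?_⟩
  · exact degree_add_lt' (hmul b₁' (b₂ t)) (hmul (b₁ t) b₂')
  · simp only [coeff_mul, coeff_add, ← Finset.sum_add_distrib]
    exact HasDerivWithinAt.fun_sum fun x _ => (d₁ x.1).mul (d₂ x.2)

lemma hasPolyDerivWithinAt_C {f : ℝ → ℝ} {f' : ℝ} (hf : HasDerivWithinAt f f' S t) :
    HasPolyDerivWithinAt (fun s => C (f s)) (C f') S t := by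
  refine ⟨⟨1, fun s => ?_, ?_⟩, fun k => ?_⟩
  · exact degree_C_le.trans_lt (by norm_num)
  · exact degree_C_le.trans_lt (by norm_num)
  · rcases k with _ | k
    · simpa using hf
    · simpa [coeff_C] using hasDerivWithinAt_const _ _ _

variable {μ : ℝ → ℕ → ℝ} {μ' : ℕ → ℝ}

/-- The product rule for `L_s (q_s)`. -/
lemma hasDerivWithinAt_momentFunctional (hμ : ∀ k, HasDerivWithinAt (fun s => μ s k) (μ' k) S t)
    (h : HasPolyDerivWithinAt q₁ q₁' S t) :
    HasDerivWithinAt (fun s => momentFunctional (μ s) (q₁ s))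
      (momentFunctional μ' (q₁ t) + momentFunctional (μ t) q₁') S t := by
  obtain ⟨⟨N, b, b'⟩, d⟩ := h
  simp only [momentFunctional_eq_sum _ (b _), momentFunctional_eq_sum _ b',
    ← Finset.sum_add_distrib]
  refine HasDerivWithinAt.fun_sum fun k _ => ?_
  rw [add_comm]
  exact (d k).mul (hμ k)

variable (hμ : ∀ k, HasDerivWithinAt (fun s => μ s k) (μ' k) S t)
  (hL : ∀ q : ℝ[X], q ≠ 0 → 0 < momentFunctional (μ t) (q * q))
include hμ hL

/-- The orthogonal polynomials depend differentiably on the parameter; as they are monic, the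
derivative of `P_n` has degree less than `n`. -/
lemma hasPolyDerivWithinAt_opPair (n : ℕ) :
    (∃ q' : ℝ[X], q'.degree < (n : WithBot ℕ) ∧
      HasPolyDerivWithinAt (fun s => op (momentFunctional (μ s)) n) q' S t) ∧
    (∃ q' : ℝ[X], q'.degree < (n : WithBot ℕ) ∧
      HasPolyDerivWithinAt (fun s => opPrev (momentFunctional (μ s)) n) q' S t) := by
  induction n with
  | zero =>
    exact ⟨⟨0, by simp, hasPolyDerivWithinAt_const 1⟩, ⟨0, by simp, hasPolyDerivWithinAt_const 0⟩⟩
  | succ n ih =>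
    obtain ⟨⟨P', hP', dP⟩, ⟨Q', hQ', dQ⟩⟩ := ih
    refine ⟨?_, P', degree_lt_mono hP' (by omega), dP⟩
    have dX := hasPolyDerivWithinAt_const (S := S) (t := t) (X : ℝ[X])
    have hh := hasDerivWithinAt_momentFunctional hμ (dP.mul dP)
    have hX := hasDerivWithinAt_momentFunctional hμ (dX.mul (dP.mul dP))
    have da := hX.div hh (opNorm_pos hL n).ne'
    have db : ∃ b', HasDerivWithinAt (fun s => recB (momentFunctional (μ s)) n) b' S t := by
      rcases n with _ | m
      · exact ⟨0, by simpa using hasDerivWithinAt_const t S (0 : ℝ)⟩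
      · exact ⟨_, hh.div (hasDerivWithinAt_momentFunctional hμ (dQ.mul dQ)) (opNorm_pos hL m).ne'⟩
    obtain ⟨b', db⟩ := db
    refine ⟨_, ?_, ((dX.mul dP).sub ((hasPolyDerivWithinAt_C da).mul dP)).sub
      ((hasPolyDerivWithinAt_C db).mul dQ)⟩
    rw [zero_mul, zero_add]
    exact degree_sub_lt' (degree_sub_lt' (degree_X_mul_lt hP')
      (degree_add_lt' (degree_C_mul_lt _ (degree_op_lt n))
        (degree_C_mul_lt _ (degree_lt_mono hP' (by omega)))))
      (degree_add_lt' (degree_C_mul_lt _ (degree_lt_mono (degree_opPrev_lt n) (by omega)))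
        (degree_C_mul_lt _ (degree_lt_mono hQ' (by omega))))

/-- By orthogonality only the functional, not the polynomial, contributes to `h_n'`. -/
lemma hasDerivWithinAt_opNorm (n : ℕ) :
    HasDerivWithinAt (fun s => opNorm (momentFunctional (μ s)) n)
      (momentFunctional μ' (op (momentFunctional (μ t)) n * op (momentFunctional (μ t)) n)) S t := by
  obtain ⟨⟨P', hP', dP⟩, -⟩ := hasPolyDerivWithinAt_opPair hμ hL n
  have h := hasDerivWithinAt_momentFunctional hμ (dP.mul dP)
  rw [map_add, mul_comm P', functional_op_mul_eq_zero hL n _ hP', add_zero, add_zero] at h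
  exact h

/-- Differentiating `L (P_{m+1} P_m) = 0` gives the derivative of the subleading coefficient. -/
lemma hasDerivWithinAt_subCoeff_succ (hS : UniqueDiffWithinAt ℝ S t) (ht : t ∈ S)
    (hLS : ∀ s ∈ S, ∀ q : ℝ[X], q ≠ 0 → 0 < momentFunctional (μ s) (q * q)) (m : ℕ) :
    HasDerivWithinAt (fun s => subCoeff (momentFunctional (μ s)) (m + 1))
      (-(momentFunctional μ' (op (momentFunctional (μ t)) (m + 1) * op (momentFunctional (μ t)) m)
        / opNorm (momentFunctional (μ t)) m)) S t := by
  obtain ⟨⟨P', hP', dP⟩, -⟩ := hasPolyDerivWithinAt_opPair hμ hL (m + 1)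
  obtain ⟨⟨Q', hQ', dQ⟩, -⟩ := hasPolyDerivWithinAt_opPair hμ hL m
  have h := hasDerivWithinAt_momentFunctional hμ (dP.mul dQ)
  rw [map_add, mul_comm P', functional_op_mul hL hP',
    functional_op_mul_eq_zero hL (m + 1) _ (degree_lt_mono hQ' (by omega)), add_zero] at h
  have h0 : HasDerivWithinAt (fun s => momentFunctional (μ s)
      (op (momentFunctional (μ s)) (m + 1) * op (momentFunctional (μ s)) m)) 0 S t :=
    (hasDerivWithinAt_const t S (0 : ℝ)).congr_of_mem
      (fun s hs => functional_op_mul_op_of_ne (hLS s hs) (by omega)) ht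
  have e := hS.eq_deriv _ h h0
  have := dP.2 m
  simp only [coeff_op_succ] at this
  refine this.congr_deriv (Eq.symm ?_)
  rw [neg_eq_iff_eq_neg, div_eq_iff (opNorm_pos hL m).ne']
  linarith

end Parameter

section Scaling

variable {L L' : ℝ[X] →ₗ[ℝ] ℝ} {κ t : ℝ}

/-- The relation `t L' (q) = L (x q' + (κ - x) q)`. It holds for the derivative `L'` of `L` in `t`
when `L (x^k) = t^{k+κ} m_k(t)` with `m_k' = -m_{k+1}`. -/
def IsScaling (κ t : ℝ) (L L' : ℝ[X] →ₗ[ℝ] ℝ) : Prop :=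
  ∀ q : ℝ[X], t * L' q = L (X * derivative q + (C κ - X) * q)

variable (hL : ∀ q : ℝ[X], q ≠ 0 → 0 < L (q * q)) (hs : IsScaling κ t L L')
include hL hs

lemma scaling_opNorm (n : ℕ) :
    t * L' (op L n * op L n) = (2 * n + κ - recA L n) * opNorm L n := by
  rw [hs]
  have hsplit : X * derivative (op L n * op L n) + (C κ - X) * (op L n * op L n) =
      C 2 * (op L n * (X * derivative (op L n))) + C κ * (op L n * op L n)
        - X * (op L n * op L n) := by
    rw [derivative_mul, map_ofNat]; ring
  have h := functional_op_mul hL (degree_X_mul_derivative_lt (degree_op_lt (L := L) n))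
  rw [coeff_X_mul_derivative, coeff_op_self] at h
  rw [hsplit, map_sub, map_add, functional_C_mul, functional_C_mul, h, functional_X_op_sq hL,
    ← opNorm]
  ring

lemma scaling_op_succ_mul_op (m : ℕ) :
    t * L' (op L (m + 1) * op L m) = -(subCoeff L (m + 1) + recB L (m + 1)) * opNorm L m := by
  rw [hs]
  have hsplit : X * derivative (op L (m + 1) * op L m) + (C κ - X) * (op L (m + 1) * op L m) =
      op L m * (X * derivative (op L (m + 1))) + op L (m + 1) * (X * derivative (op L m))
        + C κ * (op L (m + 1) * op L m) - op L (m + 1) * (X * op L m) := by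
    rw [derivative_mul]; ring
  have h1 := functional_op_mul_succ hL
    (degree_X_mul_derivative_lt (degree_op_lt (L := L) (m + 1)))
  have h2 := functional_op_mul_eq_zero hL (m + 1) _
    (degree_X_mul_derivative_lt (degree_op_lt (L := L) m))
  have h3 := functional_op_mul hL (degree_X_mul_lt (degree_op_lt (L := L) m))
  rw [coeff_X_mul_derivative, coeff_X_mul_derivative, coeff_op_self, coeff_op_succ] at h1
  rw [coeff_X_mul, coeff_op_self] at h3
  rw [hsplit, map_sub, map_add, map_add, functional_C_mul, h1, h2, h3,
    functional_op_mul_eq_zero hL (m + 1) _ (degree_op_lt m), ← recB_mul_opNorm hL m]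
  push_cast
  ring

end Scaling

section Toda

variable {μ : ℝ → ℕ → ℝ} {μ' : ℝ → ℕ → ℝ} {κ : ℝ}
  (hμ : ∀ t, 0 < t → ∀ k, HasDerivAt (fun s => μ s k) (μ' t k) t)
  (hL : ∀ t, 0 < t → ∀ q : ℝ[X], q ≠ 0 → 0 < momentFunctional (μ t) (q * q))
  (hs : ∀ t, 0 < t → IsScaling κ t (momentFunctional (μ t)) (momentFunctional (μ' t)))
include hμ hL hs

/-- The Toda equation `t h_n' = (2n + κ - a_n) h_n`. -/
lemma hasDerivAt_opNorm {t : ℝ} (ht : 0 < t) (n : ℕ) :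
    HasDerivAt (fun s => opNorm (momentFunctional (μ s)) n)
      ((2 * n + κ - recA (momentFunctional (μ t)) n) * opNorm (momentFunctional (μ t)) n / t) t := by
  have h := hasDerivWithinAt_opNorm (S := univ) (fun k => (hμ t ht k).hasDerivWithinAt)
    (hL t ht) n
  rw [hasDerivWithinAt_univ] at h
  rwa [← scaling_opNorm (hL t ht) (hs t ht) n, mul_div_cancel_left₀ _ ht.ne']

/-- The Toda equation `t p_n' = p_n + b_n`. -/
lemma hasDerivAt_subCoeff {t : ℝ} (ht : 0 < t) (n : ℕ) :
    HasDerivAt (fun s => subCoeff (momentFunctional (μ s)) n)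
      ((subCoeff (momentFunctional (μ t)) n + recB (momentFunctional (μ t)) n) / t) t := by
  rcases n with _ | m
  · simpa using hasDerivAt_const t (0 : ℝ)
  have h := hasDerivWithinAt_subCoeff_succ (S := Ioi 0)
    (fun k => (hμ t ht k).hasDerivWithinAt) (hL t ht) (uniqueDiffOn_Ioi 0 t ht) ht
    (fun s hs => hL s hs) m
  refine (h.hasDerivAt (Ioi_mem_nhds ht)).congr_deriv ?_
  have e := scaling_op_succ_mul_op (hL t ht) (hs t ht) m
  have hh := (opNorm_pos (hL t ht) m).ne'
  field_simp
  linarith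

/-- The Toda equation `t b_{m+1}' = b_{m+1} (2 + a_m - a_{m+1})`. -/
lemma hasDerivAt_recB_succ {t : ℝ} (ht : 0 < t) (m : ℕ) :
    HasDerivAt (fun s => recB (momentFunctional (μ s)) (m + 1))
      (recB (momentFunctional (μ t)) (m + 1) * (2 + recA (momentFunctional (μ t)) m
        - recA (momentFunctional (μ t)) (m + 1)) / t) t := by
  have h1 := hasDerivAt_opNorm hμ hL hs ht (m + 1)
  have h0 := hasDerivAt_opNorm hμ hL hs ht m
  have hh := (opNorm_pos (hL t ht) m).ne'
  simp only [recB_succ]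
  refine (h1.fun_div h0 hh).congr_deriv ?_
  have := ht.ne'
  field_simp
  push_cast
  ring

end Toda

/-! ### The moments as integrals -/

/-- The integrand `x^s e^{-b x} |x - c|^γ (A + B θ(x - c))`. The case `b = 1`, `c = t` gives the
moments; the case `b = t`, `c = 1` is its rescaling, which is smooth in `t`. -/
def kernel (γ A B s b c x : ℝ) : ℝ :=
  x ^ s * Real.exp (-(b * x)) * (|x - c| ^ γ * (A + B * heaviside (x - c)))

/-- The integral of `kernel` over `(0, ∞)`. -/
def kernelIntegral (γ A B s b c : ℝ) : ℝ := ∫ x in Ioi (0 : ℝ), kernel γ A B s b c x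

variable {γ A B s b c : ℝ}

lemma measurable_heaviside : Measurable heaviside :=
  Measurable.ite measurableSet_Ioi measurable_const measurable_const

lemma abs_jump_le (u : ℝ) : |A + B * heaviside u| ≤ |A| + |B| := by
  refine (abs_add_le _ _).trans ?_
  rw [abs_mul]
  have : |heaviside u| ≤ 1 := by unfold heaviside; split_ifs <;> simp
  nlinarith [abs_nonneg B]

lemma jump_nonneg (hA : 0 ≤ A) (hAB : 0 ≤ A + B) (u : ℝ) : 0 ≤ A + B * heaviside u := by
  unfold heaviside; split_ifs <;> simpa

lemma measurable_kernel : Measurable (kernel γ A B s b c) := by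
  have := measurable_heaviside
  unfold kernel
  fun_prop

lemma kernel_succ {x : ℝ} (hx : 0 < x) : kernel γ A B (s + 1) b c x = x * kernel γ A B s b c x := by
  unfold kernel
  rw [Real.rpow_add_one hx.ne']; ring

lemma abs_kernel_le (hγ : 0 < γ) {C x : ℝ} (hx : 0 < x) (hc : 0 ≤ c) (hcC : c ≤ C) :
    |kernel γ A B s b c x| ≤ (|A| + |B|) * 2 ^ γ *
      (x ^ (s + γ) * Real.exp (-b * x ^ (1 : ℝ)) + C ^ γ * (x ^ s * Real.exp (-b * x ^ (1 : ℝ)))) := by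
  have hC : 0 ≤ C := hc.trans hcC
  have h1 : |x - c| ^ γ ≤ 2 ^ γ * (x ^ γ + C ^ γ) := by
    have h2 : |x - c| ≤ 2 * max x C := by
      rw [abs_le]
      constructor <;> linarith [le_max_left x C, le_max_right x C, hx]
    calc |x - c| ^ γ ≤ (2 * max x C) ^ γ := Real.rpow_le_rpow (abs_nonneg _) h2 hγ.le
      _ = 2 ^ γ * (max x C) ^ γ := Real.mul_rpow (by norm_num) (hx.le.trans (le_max_left _ _))
      _ ≤ 2 ^ γ * (x ^ γ + C ^ γ) := by
        gcongr
        rcases max_choice x C with h | h <;> rw [h]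
        · linarith [Real.rpow_nonneg hC γ]
        · linarith [Real.rpow_nonneg hx.le γ]
  have h3 := Real.rpow_nonneg (abs_nonneg (x - c)) γ
  have h4 : 0 ≤ x ^ s * Real.exp (-(b * x)) := by positivity
  unfold kernel
  rw [abs_mul, abs_of_nonneg h4, abs_mul, abs_of_nonneg h3, Real.rpow_one, neg_mul,
    Real.rpow_add hx]
  calc x ^ s * Real.exp (-(b * x)) * (|x - c| ^ γ * |A + B * heaviside (x - c)|)
      ≤ x ^ s * Real.exp (-(b * x)) * ((2 ^ γ * (x ^ γ + C ^ γ)) * (|A| + |B|)) := by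
        gcongr
        exact abs_jump_le _
    _ = _ := by ring

lemma integrableOn_kernel_bound (hγ : 0 < γ) (hs : -1 < s) (hb : 0 < b) (C : ℝ) :
    IntegrableOn (fun x : ℝ => (|A| + |B|) * 2 ^ γ *
      (x ^ (s + γ) * Real.exp (-b * x ^ (1 : ℝ)) + C ^ γ * (x ^ s * Real.exp (-b * x ^ (1 : ℝ)))))
      (Ioi 0) :=
  Integrable.const_mul ((integrableOn_rpow_mul_exp_neg_mul_rpow (by linarith) one_pos hb).add
    ((integrableOn_rpow_mul_exp_neg_mul_rpow hs one_pos hb).const_mul _)) _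

lemma integrableOn_kernel (hγ : 0 < γ) (hs : -1 < s) (hb : 0 < b) (hc : 0 ≤ c) :
    IntegrableOn (kernel γ A B s b c) (Ioi 0) := by
  refine Integrable.mono' (integrableOn_kernel_bound (A := A) (B := B) hγ hs hb c)
    measurable_kernel.aestronglyMeasurable ?_
  refine (ae_restrict_iff' measurableSet_Ioi).2 (ae_of_all _ fun x hx => ?_)
  exact abs_kernel_le hγ hx hc le_rfl

/-- The substitution `x = t y`. -/
lemma kernelIntegral_scaling {t : ℝ} (ht : 0 < t) :
    kernelIntegral γ A B s 1 t = t ^ (s + γ + 1) * kernelIntegral γ A B s t 1 := by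
  have h := integral_comp_mul_left_Ioi' (fun x => kernel γ A B s 1 t x) 0 ht
  rw [mul_zero] at h
  unfold kernelIntegral
  rw [← h, smul_eq_mul, Real.rpow_add_one ht.ne', mul_comm _ t, mul_assoc,
    ← integral_const_mul (t ^ (s + γ))]
  congr 1
  refine setIntegral_congr_fun measurableSet_Ioi fun y hy => ?_
  have hy' : (0 : ℝ) < y := hy
  have hh : heaviside (t * y - t) = heaviside (y - 1) := by
    unfold heaviside
    congr 1
    have : t * y - t = t * (y - 1) := by ring
    rw [this, mul_pos_iff_of_pos_left ht]
  have ha : |t * y - t| = t * |y - 1| := by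
    rw [show t * y - t = t * (y - 1) by ring, abs_mul, abs_of_pos ht]
  simp only [kernel]
  rw [hh, ha, Real.mul_rpow ht.le hy'.le, Real.mul_rpow ht.le (abs_nonneg _), Real.rpow_add ht,
    one_mul]
  ring

/-- Differentiation under the integral sign in the rescaled moments. -/
lemma hasDerivAt_kernelIntegral_rescaled (hγ : 0 < γ) (hs : -1 < s) {t : ℝ} (ht : 0 < t) :
    HasDerivAt (fun t => kernelIntegral γ A B s t 1) (-kernelIntegral γ A B (s + 1) t 1) t := by
  have h := hasDerivAt_integral_of_dominated_loc_of_deriv_le (𝕜 := ℝ)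
    (μ := volume.restrict (Ioi (0 : ℝ)))
    (F := fun t x => kernel γ A B s t 1 x) (F' := fun t x => -kernel γ A B (s + 1) t 1 x)
    (x₀ := t) (s := Ioi (t / 2)) (bound := fun x => ‖kernel γ A B (s + 1) (t / 2) 1 x‖)
    (Ioi_mem_nhds (by linarith))
    (Eventually.of_forall fun _ => measurable_kernel.aestronglyMeasurable)
    (integrableOn_kernel hγ hs ht zero_le_one) measurable_kernel.neg.aestronglyMeasurable ?_
    (integrableOn_kernel hγ (by linarith) (by linarith) zero_le_one).norm ?_
  · have h2 := h.2
    rw [integral_neg] at h2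
    exact h2
  · refine (ae_restrict_iff' measurableSet_Ioi).2 (ae_of_all _ fun x hx u hu => ?_)
    have hx' : (0 : ℝ) < x := hx
    have hu' : t / 2 < u := hu
    unfold kernel
    rw [norm_neg, norm_mul, norm_mul (_ * _), norm_mul, norm_mul (x ^ (s + 1))]
    gcongr
    rw [Real.norm_of_nonneg (Real.exp_pos _).le, Real.norm_of_nonneg (Real.exp_pos _).le]
    gcongr
  · refine (ae_restrict_iff' measurableSet_Ioi).2 (ae_of_all _ fun x hx u hu => ?_)
    rw [kernel_succ hx]
    unfold kernel
    have h1 : HasDerivAt (fun u : ℝ => Real.exp (-(u * x))) (Real.exp (-(u * x)) * (-x)) u := by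
      have := ((hasDerivAt_id u).mul_const x).neg.exp
      simpa using this
    refine ((h1.const_mul (x ^ s)).mul_const _).congr_deriv ?_
    ring

/-- Multiplied by `u`, the factor `|u|^γ (A + B θ(u))` is differentiable even at `u = 0`. -/
lemma hasDerivAt_singular_factor (hγ : 0 < γ) (u : ℝ) :
    HasDerivAt (fun u : ℝ => u * (|u| ^ γ * (A + B * heaviside u)))
      ((γ + 1) * (|u| ^ γ * (A + B * heaviside u))) u := by
  rcases lt_trichotomy u 0 with hu | rfl | hu
  · have h : HasDerivAt (fun u : ℝ => -(-u) ^ (γ + 1) * A) ((γ + 1) * (|u| ^ γ * A)) u := by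
      have := (((hasDerivAt_id u).neg.rpow_const (p := γ + 1)
        (Or.inl (by simpa using hu.ne))).neg).mul_const A
      refine this.congr_deriv ?_
      simp only [Pi.neg_apply, id, abs_of_neg hu, add_sub_cancel_right]
      ring
    have h0 : heaviside u = 0 := by simp [heaviside, hu.le]
    rw [h0, mul_zero, add_zero]
    refine h.congr_of_eventuallyEq ?_
    filter_upwards [Iio_mem_nhds hu] with v hv
    have hv' : v < 0 := hv
    have h0 : heaviside v = 0 := by simp [heaviside, hv'.le]
    rw [h0, abs_of_neg hv', Real.rpow_add_one (by linarith)]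
    ring
  · have h0 : (0 : ℝ) ^ γ = 0 := Real.zero_rpow hγ.ne'
    simp only [abs_zero, h0, zero_mul, mul_zero]
    rw [hasDerivAt_iff_tendsto_slope]
    have hbd : ∀ v : ℝ, ‖|v| ^ γ * (A + B * heaviside v)‖ ≤ |v| ^ γ * (|A| + |B|) := by
      intro v
      rw [norm_mul, Real.norm_of_nonneg (Real.rpow_nonneg (abs_nonneg v) γ)]
      exact mul_le_mul_of_nonneg_left (abs_jump_le v) (Real.rpow_nonneg (abs_nonneg v) γ)
    have hlim : Tendsto (fun v : ℝ => |v| ^ γ * (|A| + |B|)) (𝓝 0) (𝓝 0) := by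
      have : ContinuousAt (fun v : ℝ => |v| ^ γ * (|A| + |B|)) 0 := by
        refine ContinuousAt.mul ?_ continuousAt_const
        exact continuous_abs.continuousAt.rpow_const (Or.inr hγ.le)
      simpa [ContinuousAt, h0] using this
    have h1 := squeeze_zero_norm hbd hlim
    refine (h1.mono_left nhdsWithin_le_nhds).congr' ?_
    filter_upwards [self_mem_nhdsWithin] with v hv
    have hv' : v ≠ 0 := hv
    rw [slope_def_field]
    field_simp
    simp
  · have h : HasDerivAt (fun u : ℝ => u ^ (γ + 1) * (A + B)) ((γ + 1) * (|u| ^ γ * (A + B))) u := by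
      refine ((Real.hasDerivAt_rpow_const (p := γ + 1) (Or.inl hu.ne')).mul_const
        (A + B)).congr_deriv ?_
      rw [abs_of_pos hu, add_sub_cancel_right]; ring
    have h0 : heaviside u = 1 := by simp [heaviside, hu]
    rw [h0, mul_one]
    refine h.congr_of_eventuallyEq ?_
    filter_upwards [Ioi_mem_nhds hu] with v hv
    have hv' : 0 < v := hv
    have h0 : heaviside v = 1 := by simp [heaviside, hv']
    rw [h0, abs_of_pos hv', Real.rpow_add_one hv'.ne']
    ring

/-- Integration by parts: the total derivative of `x (x - t)` times the integrand vanishes. -/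
lemma kernelIntegral_pearson (hγ : 0 < γ) (hs : -1 < s) {t : ℝ} (ht : 0 ≤ t) :
    (s + 1) * (kernelIntegral γ A B (s + 1) 1 t - t * kernelIntegral γ A B s 1 t)
      + (γ + 1) * kernelIntegral γ A B (s + 1) 1 t
      - (kernelIntegral γ A B (s + 2) 1 t - t * kernelIntegral γ A B (s + 1) 1 t) = 0 := by
  set V : ℝ → ℝ := fun x => (x - t) * (|x - t| ^ γ * (A + B * heaviside (x - t))) with hV
  set G : ℝ → ℝ := fun x => x ^ (s + 1) * Real.exp (-x) * V x with hG
  set g : ℝ → ℝ := fun x => (s + 1) * (kernel γ A B (s + 1) 1 t x - t * kernel γ A B s 1 t x)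
      + (γ + 1) * kernel γ A B (s + 1) 1 t x
      - (kernel γ A B (s + 2) 1 t x - t * kernel γ A B (s + 1) 1 t x) with hg
  have i0 := integrableOn_kernel (A := A) (B := B) hγ hs one_pos ht
  have i1 := integrableOn_kernel (A := A) (B := B) (s := s + 1) hγ (by linarith) one_pos ht
  have i2 := integrableOn_kernel (A := A) (B := B) (s := s + 2) hγ (by linarith) one_pos ht
  have hVd : ∀ x, HasDerivAt V ((γ + 1) * (|x - t| ^ γ * (A + B * heaviside (x - t)))) x := by
    intro x
    exact (hasDerivAt_singular_factor (A := A) (B := B) hγ (x - t)).comp_sub_const x t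
  have hGd : ∀ x ∈ Ioi (0 : ℝ), HasDerivAt G (g x) x := by
    intro x hx
    have hx' : (0 : ℝ) < x := hx
    have h1 := Real.hasDerivAt_rpow_const (x := x) (p := s + 1) (Or.inl hx'.ne')
    have h2 : HasDerivAt (fun x : ℝ => Real.exp (-x)) (-Real.exp (-x)) x := by
      simpa using (hasDerivAt_neg x).exp
    refine ((h1.mul h2).mul (hVd x)).congr_deriv ?_
    have e2 : x ^ (s + 2) = x ^ s * x * x := by
      rw [← Real.rpow_add_one hx'.ne', ← Real.rpow_add_one hx'.ne']; congr 1; ring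
    simp only [hg, hV, kernel, one_mul, Pi.mul_apply, add_sub_cancel_right, e2,
      Real.rpow_add_one hx'.ne' s]
    ring
  have hgi : IntegrableOn g (Ioi 0) :=
    (((i1.sub (i0.const_mul t)).const_mul (s + 1)).add (i1.const_mul (γ + 1))).sub
      (i2.sub (i1.const_mul t))
  have hGi : IntegrableOn G (Ioi 0) := by
    refine (i2.sub (i1.const_mul t)).congr_fun (fun x hx => ?_) measurableSet_Ioi
    have hx' : (0 : ℝ) < x := hx
    have e2 : x ^ (s + 2) = x ^ s * x * x := by
      rw [← Real.rpow_add_one hx'.ne', ← Real.rpow_add_one hx'.ne']; congr 1; ring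
    simp only [hG, hV, kernel, one_mul, Pi.sub_apply, e2, Real.rpow_add_one hx'.ne' s]
    ring
  have hlim := tendsto_zero_of_hasDerivAt_of_integrableOn_Ioi hGd hgi hGi
  have hcont : ContinuousWithinAt G (Ici 0) 0 := by
    refine ContinuousAt.continuousWithinAt ?_
    refine ContinuousAt.mul (ContinuousAt.mul ?_ ?_) (hVd 0).continuousAt
    · exact continuousAt_id.rpow_const (Or.inr (by linarith))
    · exact (Real.continuous_exp.comp continuous_neg).continuousAt
  have h := integral_Ioi_of_hasDerivAt_of_tendsto hcont hGd hgi hlim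
  have hG0 : G 0 = 0 := by simp [hG, Real.zero_rpow (by linarith : s + 1 ≠ 0)]
  rw [hG0, sub_zero] at h
  rw [← h]
  have j01 : IntegrableOn (fun x => kernel γ A B (s + 1) 1 t x - t * kernel γ A B s 1 t x)
    (Ioi 0) := i1.sub (i0.const_mul t)
  have j12 : IntegrableOn (fun x => kernel γ A B (s + 2) 1 t x - t * kernel γ A B (s + 1) 1 t x)
    (Ioi 0) := i2.sub (i1.const_mul t)
  have k1 : IntegrableOn (fun x => (γ + 1) * kernel γ A B (s + 1) 1 t x) (Ioi 0) := i1.const_mul _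
  have k01 : IntegrableOn (fun x => (s + 1) * (kernel γ A B (s + 1) 1 t x
    - t * kernel γ A B s 1 t x)) (Ioi 0) := j01.const_mul _
  have l : IntegrableOn (fun x => (s + 1) * (kernel γ A B (s + 1) 1 t x
    - t * kernel γ A B s 1 t x) + (γ + 1) * kernel γ A B (s + 1) 1 t x) (Ioi 0) := k01.add k1
  simp only [hg, kernelIntegral]
  rw [integral_sub l j12, integral_add k01 k1, integral_const_mul, integral_const_mul,
    integral_sub i1 (i0.const_mul t), integral_sub i2 (i1.const_mul t), integral_const_mul,
    integral_const_mul]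

/-- The derivative of the moments falls on the smooth factor `x^s e^{-x}`, not on the singular
one. -/
lemma hasDerivAt_kernelIntegral (hγ : 0 < γ) (hs : 0 < s) {t : ℝ} (ht : 0 < t) :
    HasDerivAt (fun t => kernelIntegral γ A B s 1 t)
      (s * kernelIntegral γ A B (s - 1) 1 t - kernelIntegral γ A B s 1 t) t ∧
    t * (s * kernelIntegral γ A B (s - 1) 1 t - kernelIntegral γ A B s 1 t) =
      (s + γ + 1) * kernelIntegral γ A B s 1 t - kernelIntegral γ A B (s + 1) 1 t := by
  have hp := kernelIntegral_pearson (A := A) (B := B) (s := s - 1) hγ (by linarith) ht.le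
  rw [sub_add_cancel, show s - 1 + 2 = s + 1 by ring] at hp
  have e : t * (s * kernelIntegral γ A B (s - 1) 1 t - kernelIntegral γ A B s 1 t) =
      (s + γ + 1) * kernelIntegral γ A B s 1 t - kernelIntegral γ A B (s + 1) 1 t := by
    linear_combination -hp
  refine ⟨?_, e⟩
  have h := (Real.hasDerivAt_rpow_const (x := t) (p := s + γ + 1) (Or.inl ht.ne')).mul
    (hasDerivAt_kernelIntegral_rescaled (A := A) (B := B) (s := s) hγ (by linarith) ht)
  have h' : HasDerivAt (fun t => kernelIntegral γ A B s 1 t)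
      ((s + γ + 1) * t ^ (s + γ + 1 - 1) * kernelIntegral γ A B s t 1
        + t ^ (s + γ + 1) * -kernelIntegral γ A B (s + 1) t 1) t := by
    refine h.congr_of_eventuallyEq ?_
    filter_upwards [Ioi_mem_nhds ht] with u hu
    exact kernelIntegral_scaling hu
  refine h'.congr_deriv ?_
  have e1 : t ^ (s + 1 + γ + 1) = t ^ (s + γ + 1) * t := by
    rw [← Real.rpow_add_one ht.ne']; ring_nf
  refine mul_left_cancel₀ ht.ne' ?_
  rw [e, kernelIntegral_scaling ht, kernelIntegral_scaling ht, Real.rpow_sub_one ht.ne', e1]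
  generalize t ^ (s + γ + 1) = T
  field_simp
  ring

lemma continuousWithinAt_kernelIntegral_zero (hγ : 0 < γ) (hs : -1 < s) :
    ContinuousWithinAt (fun t => kernelIntegral γ A B s 1 t) (Ici 0) 0 := by
  refine continuousWithinAt_of_dominated
    (Eventually.of_forall fun _ => measurable_kernel.aestronglyMeasurable) ?_
    (integrableOn_kernel_bound (A := A) (B := B) hγ hs one_pos 1) ?_
  · have : Iio (1 : ℝ) ∈ 𝓝[Ici 0] (0 : ℝ) := nhdsWithin_le_nhds (Iio_mem_nhds one_pos)
    filter_upwards [self_mem_nhdsWithin, this] with t ht ht1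
    refine (ae_restrict_iff' measurableSet_Ioi).2 (ae_of_all _ fun x hx => ?_)
    exact abs_kernel_le hγ hx ht (le_of_lt ht1)
  · refine (ae_restrict_iff' measurableSet_Ioi).2 (ae_of_all _ fun x hx => ?_)
    have hx' : (0 : ℝ) < x := hx
    refine ContinuousAt.continuousWithinAt ?_
    have hc : ContinuousAt
        (fun t : ℝ => x ^ s * Real.exp (-(1 * x)) * (|x - t| ^ γ * (A + B))) 0 := by
      refine ContinuousAt.mul continuousAt_const (ContinuousAt.mul ?_ continuousAt_const)
      refine ContinuousAt.rpow_const ?_ (Or.inr hγ.le)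
      exact (continuous_abs.comp (continuous_const.sub continuous_id)).continuousAt
    refine hc.congr ?_
    filter_upwards [Iio_mem_nhds hx'] with t ht
    have : heaviside (x - t) = 1 := by simp [heaviside, show t < x from ht]
    simp [kernel, this]

/-- At `t = 0` the moments are those of the classical Laguerre weight `(A + B) x^{s+γ} e^{-x}`. -/
lemma kernelIntegral_zero (hγ : 0 < γ) (hs : -1 < s) :
    kernelIntegral γ A B s 1 0 = (A + B) * Real.Gamma (s + γ + 1) := by
  rw [Real.Gamma_eq_integral (by linarith), ← integral_const_mul, kernelIntegral]
  refine setIntegral_congr_fun measurableSet_Ioi fun x hx => ?_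
  have hx' : (0 : ℝ) < x := hx
  have : heaviside x = 1 := by simp [heaviside, hx']
  simp only [kernel, sub_zero, this, abs_of_pos hx', one_mul, add_sub_cancel_right,
    Real.rpow_add hx']
  ring

lemma hasDerivWithinAt_kernelIntegral (hγ : 0 < γ) (hs : 0 < s) {t : ℝ} (ht : 0 ≤ t) :
    HasDerivWithinAt (fun t => kernelIntegral γ A B s 1 t)
      (s * kernelIntegral γ A B (s - 1) 1 t - kernelIntegral γ A B s 1 t) (Ici 0) t := by
  rcases ht.eq_or_lt with rfl | ht
  · have hc := continuousWithinAt_kernelIntegral_zero (A := A) (B := B) hγ (by linarith : -1 < s)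
    have hc' := continuousWithinAt_kernelIntegral_zero (A := A) (B := B) hγ
      (by linarith : -1 < s - 1)
    refine hasDerivWithinAt_Ici_of_tendsto_deriv (s := Ioi 0)
      (fun u hu => (hasDerivAt_kernelIntegral hγ hs hu).1.differentiableAt.differentiableWithinAt)
      (hc.mono Ioi_subset_Ici_self) self_mem_nhdsWithin ?_
    have hl := ((hc'.const_mul s).sub hc).mono Ioi_subset_Ici_self
    refine Tendsto.congr' ?_ hl
    filter_upwards [self_mem_nhdsWithin] with u hu
    exact (hasDerivAt_kernelIntegral hγ hs hu).1.deriv.symm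
  · exact (hasDerivAt_kernelIntegral hγ hs ht).1.hasDerivWithinAt

/-! ### The moment functional of the perturbed Laguerre weight -/

/-- The moments `∫ x^k w(x,t) dx`. -/
def moment (α γ A B t : ℝ) (k : ℕ) : ℝ := kernelIntegral γ A B (k + α) 1 t

/-- The derivatives of the moments with respect to `t`. -/
def momentDeriv (α γ A B t : ℝ) (k : ℕ) : ℝ :=
  (k + α) * kernelIntegral γ A B (k + α - 1) 1 t - kernelIntegral γ A B (k + α) 1 t

/-- The linear functional `q ↦ ∫ q(x) w(x,t) dx`. -/
abbrev laguerreFunctional (α γ A B t : ℝ) : ℝ[X] →ₗ[ℝ] ℝ := momentFunctional (moment α γ A B t)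

variable {α γ A B t : ℝ}

lemma kernel_natCast_add {s x : ℝ} (hx : 0 < x) (k : ℕ) :
    kernel γ A B (k + s) 1 t x = x ^ k * kernel γ A B s 1 t x := by
  unfold kernel
  rw [Real.rpow_add hx, Real.rpow_natCast]; ring

lemma integral_pow_mul_weight (k : ℕ) :
    ∫ x in Ioi (0 : ℝ), x ^ k * weight α γ A B x t = moment α γ A B t k := by
  refine setIntegral_congr_fun measurableSet_Ioi fun x hx => ?_
  rw [kernel_natCast_add hx]
  simp only [weight, kernel, one_mul]
  ring

section

variable (hα : 0 < α) (hγ : 0 < γ)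
include hα hγ

lemma integrableOn_eval_mul_kernel (ht : 0 ≤ t) (q : ℝ[X]) :
    IntegrableOn (fun x => q.eval x * kernel γ A B α 1 t x) (Ioi 0) ∧
    laguerreFunctional α γ A B t q = ∫ x in Ioi (0 : ℝ), q.eval x * kernel γ A B α 1 t x := by
  have hq : q.degree < ((q.natDegree + 1 : ℕ) : WithBot ℕ) :=
    degree_le_natDegree.trans_lt (by exact_mod_cast Nat.lt_succ_self _)
  have hi : ∀ k ∈ Finset.range (q.natDegree + 1), IntegrableOn
      (fun x => q.coeff k * kernel γ A B (k + α) 1 t x) (Ioi 0) := fun k _ =>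
    (integrableOn_kernel hγ (by linarith [(Nat.cast_nonneg k : (0 : ℝ) ≤ k)]) one_pos
      ht).const_mul _
  have he : EqOn (fun x => ∑ k ∈ Finset.range (q.natDegree + 1),
      q.coeff k * kernel γ A B (k + α) 1 t x) (fun x => q.eval x * kernel γ A B α 1 t x)
      (Ioi 0) := by
    intro x hx
    simp only
    rw [eval_eq_sum_range, Finset.sum_mul]
    exact Finset.sum_congr rfl fun k _ => by rw [kernel_natCast_add hx, mul_assoc]
  refine ⟨IntegrableOn.congr_fun (integrable_finsetSum _ hi) he measurableSet_Ioi, ?_⟩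
  rw [← setIntegral_congr_fun measurableSet_Ioi he, integral_finsetSum _ hi,
    momentFunctional_eq_sum _ hq]
  exact Finset.sum_congr rfl fun k _ => (integral_const_mul _ _).symm

/-- Positive definiteness: the weight is positive on `(t, ∞)` if `A + B > 0`, and on `(0, t)` if
`A > 0`. -/
lemma laguerreFunctional_pos (hA : 0 ≤ A) (hAB : 0 ≤ A + B) (hne : A ≠ 0 ∨ B ≠ 0) (ht : 0 ≤ t)
    (ht0 : t = 0 → 0 < A + B) (q : ℝ[X]) (hq : q ≠ 0) :
    0 < laguerreFunctional α γ A B t (q * q) := by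
  obtain ⟨hi, he⟩ := integrableOn_eval_mul_kernel (A := A) (B := B) hα hγ ht (q * q)
  rw [he, setIntegral_pos_iff_support_of_nonneg_ae _ hi]
  · obtain ⟨u, v, huv, hu, hpos⟩ : ∃ u v : ℝ, u < v ∧ 0 ≤ u ∧
        ∀ x ∈ Ioo u v, x - t ≠ 0 ∧ 0 < A + B * heaviside (x - t) := by
      rcases hAB.eq_or_lt with h | h
      · have htpos : 0 < t := ht.lt_of_ne fun h' => (ht0 h'.symm).ne h
        refine ⟨0, t, htpos, le_rfl, fun x hx => ⟨by linarith [hx.2], ?_⟩⟩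
        have hA' : 0 < A := hA.lt_of_ne fun h' => by
          rcases hne with h1 | h1
          · exact h1 h'.symm
          · exact h1 (by linarith)
        simpa [heaviside, not_lt.2 hx.2.le] using hA'
      · refine ⟨t, t + 1, by linarith, ht, fun x hx => ⟨by linarith [hx.1], ?_⟩⟩
        simpa [heaviside, hx.1] using h
    have hsub : Ioo u v \ (q.roots.toFinset : Set ℝ) ⊆
        Function.support (fun x => (q * q).eval x * kernel γ A B α 1 t x) ∩ Ioi 0 := by
      rintro x ⟨hx, hxr⟩
      have hx0 : 0 < x := hu.trans_lt hx.1
      obtain ⟨h1, h2⟩ := hpos x hx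
      refine ⟨?_, hx0⟩
      have hr : q.eval x ≠ 0 := by simpa [hq] using hxr
      have h3 := Real.rpow_pos_of_pos (abs_pos.2 h1) γ
      have h4 := Real.rpow_pos_of_pos hx0 α
      rw [Function.mem_support, eval_mul, kernel]
      have h5 := Real.exp_pos (-(1 * x))
      positivity
    refine lt_of_lt_of_le ?_ (measure_mono hsub)
    rw [measure_sdiff_null (Finset.measure_zero _ _), Real.volume_Ioo]
    simpa using huv
  · refine (ae_restrict_iff' measurableSet_Ioi).2 (ae_of_all _ fun x hx => ?_)
    have hx' : (0 : ℝ) < x := hx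
    have h1 := jump_nonneg hA hAB (x - t)
    have h2 := mul_self_nonneg (q.eval x)
    simp only [Pi.zero_apply, eval_mul, kernel]
    positivity

lemma hasDerivWithinAt_moment (ht : 0 ≤ t) (k : ℕ) :
    HasDerivWithinAt (fun s => moment α γ A B s k) (momentDeriv α γ A B t k) (Ici 0) t :=
  hasDerivWithinAt_kernelIntegral hγ (by positivity) ht

lemma hasDerivAt_moment (ht : 0 < t) (k : ℕ) :
    HasDerivAt (fun s => moment α γ A B s k) (momentDeriv α γ A B t k) t :=
  (hasDerivAt_kernelIntegral hγ (by positivity) ht).1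

omit hα hγ in
lemma X_mul_derivative_monomial (k : ℕ) (c : ℝ) :
    X * derivative (monomial k c) = C (c * k) * X ^ k := by
  ext j
  rw [coeff_X_mul_derivative, coeff_monomial, coeff_C_mul_X_pow]
  by_cases h : j = k
  · simp [h, mul_comm]
  · simp [h, Ne.symm h]

lemma isPearson_laguerreFunctional (ht : 0 ≤ t) :
    IsPearson α γ t (laguerreFunctional α γ A B t) := by
  intro q
  induction q using Polynomial.induction_on' with
  | add p q hp hq =>
    rw [derivative_add, mul_add, mul_add, add_add_add_comm, map_add, hp, hq, add_zero]
  | monomial k c =>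
    have hsplit : X * (X - C t) * derivative (monomial k c)
        + (C (α + 1) * (X - C t) + C (γ + 1) * X - X * (X - C t)) * monomial k c =
        C (c * (k + α + γ + 2 + t)) * X ^ (k + 1) - C (c * (t * (k + α + 1))) * X ^ k
          - C c * X ^ (k + 2) := by
      have : X * (X - C t) * derivative (monomial k c)
          = (X - C t) * (X * derivative (monomial k c)) := by ring
      rw [this, X_mul_derivative_monomial, ← C_mul_X_pow_eq_monomial]
      simp only [C_add, C_mul, C_1, map_ofNat]
      ring
    have h := kernelIntegral_pearson (A := A) (B := B) (s := k + α) hγ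
      (by linarith [(Nat.cast_nonneg k : (0 : ℝ) ≤ k)]) ht
    rw [hsplit, map_sub, map_sub, functional_C_mul, functional_C_mul, functional_C_mul,
      momentFunctional_X_pow, momentFunctional_X_pow, momentFunctional_X_pow]
    simp only [moment]
    rw [show ((k + 1 : ℕ) : ℝ) + α = k + α + 1 by push_cast; ring,
      show ((k + 2 : ℕ) : ℝ) + α = k + α + 2 by push_cast; ring]
    linear_combination c * h

lemma isScaling_laguerreFunctional (ht : 0 < t) :
    IsScaling (α + γ + 1) t (laguerreFunctional α γ A B t)
      (momentFunctional (momentDeriv α γ A B t)) := by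
  intro q
  induction q using Polynomial.induction_on' with
  | add p q hp hq =>
    rw [derivative_add, mul_add, mul_add, add_add_add_comm, map_add, map_add, ← hp, ← hq, mul_add]
  | monomial k c =>
    have hsplit : X * derivative (monomial k c) + (C (α + γ + 1) - X) * monomial k c =
        C (c * (k + α + γ + 1)) * X ^ k - C c * X ^ (k + 1) := by
      rw [X_mul_derivative_monomial, ← C_mul_X_pow_eq_monomial]
      simp only [C_add, C_mul, C_1]
      ring
    have h := (hasDerivAt_kernelIntegral (A := A) (B := B) (s := k + α) hγ (by positivity) ht).2
    rw [hsplit, map_sub, functional_C_mul, functional_C_mul, momentFunctional_X_pow,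
      momentFunctional_X_pow, ← C_mul_X_pow_eq_monomial, functional_C_mul, momentFunctional_X_pow]
    simp only [moment, momentDeriv]
    rw [show ((k + 1 : ℕ) : ℝ) + α = k + α + 1 by push_cast; ring]
    linear_combination c * h

/-- At `t = 0`, with `a = α + γ`, integration by parts against the classical weight `x^a e^{-x}`
expresses the derivative functional `-γ L (q / x)` through `L`. -/
lemma momentDeriv_zero (q : ℝ[X]) :
    (α + γ) * momentFunctional (momentDeriv α γ A B 0) q =
      -γ * laguerreFunctional α γ A B 0 (q - derivative q) := by
  induction q using Polynomial.induction_on' with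
  | add p q hp hq =>
    rw [derivative_add, map_add, mul_add, hp, hq, add_sub_add_comm, map_add, mul_add]
  | monomial k c =>
    have hpos : 0 < (k : ℝ) + α + γ := by positivity
    have h1 : kernelIntegral γ A B (k + α) 1 0
        = (k + α + γ) * ((A + B) * Real.Gamma (k + α + γ)) := by
      rw [kernelIntegral_zero hγ (by linarith [(Nat.cast_nonneg k : (0 : ℝ) ≤ k)]),
        Real.Gamma_add_one hpos.ne']
      ring
    have h0 : kernelIntegral γ A B (k + α - 1) 1 0 = (A + B) * Real.Gamma (k + α + γ) := by
      rw [kernelIntegral_zero hγ (by linarith [(Nat.cast_nonneg k : (0 : ℝ) ≤ k)])]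
      congr 2; ring
    rw [map_sub, derivative_monomial, ← C_mul_X_pow_eq_monomial, ← C_mul_X_pow_eq_monomial,
      functional_C_mul, functional_C_mul, functional_C_mul, momentFunctional_X_pow,
      momentFunctional_X_pow, momentFunctional_X_pow]
    have h2 : (k : ℝ) * moment α γ A B 0 (k - 1) = k * ((A + B) * Real.Gamma (k + α + γ)) := by
      rcases k with _ | k
      · simp
      · rw [moment, Nat.add_sub_cancel, ← h0]
        congr 2; push_cast; ring
    simp only [momentDeriv, h0, h1, moment] at h2 ⊢
    linear_combination -γ * c * h2

end

/-! ### The Hankel determinant and its logarithmic derivative -/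

/-- Continuity of `L_s (q_s)` for continuous moments and a differentiable family `q`. -/
lemma continuousWithinAt_momentFunctional {q : ℝ → ℝ[X]} {q' : ℝ[X]} {S : Set ℝ} {t : ℝ}
    {ν : ℝ → ℕ → ℝ} (hν : ∀ k, ContinuousWithinAt (fun s => ν s k) S t)
    (h : HasPolyDerivWithinAt q q' S t) :
    ContinuousWithinAt (fun s => momentFunctional (ν s) (q s)) S t := by
  obtain ⟨⟨N, b, -⟩, d⟩ := h
  simp only [momentFunctional_eq_sum _ (b _)]
  exact tendsto_finsetSum _ fun k _ => (d k).continuousWithinAt.mul (hν k)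

variable {α γ A B : ℝ}

section

variable (hα : 0 < α) (hγ : 0 < γ) (hA : 0 ≤ A) (hAB : 0 ≤ A + B) (hne : A ≠ 0 ∨ B ≠ 0)
include hα hγ hA hAB hne

lemma hankelDet_eq_prod {t : ℝ} (ht : 0 ≤ t) (ht0 : t = 0 → 0 < A + B) (n : ℕ) :
    hankelDet α γ A B n t = ∏ j ∈ Finset.range n, opNorm (laguerreFunctional α γ A B t) j := by
  rw [← det_moments_eq_prod (laguerreFunctional_pos hα hγ hA hAB hne ht ht0), hankelDet]
  simp only [momentFunctional_X_pow, integral_pow_mul_weight]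

lemma hankelDet_pos {t : ℝ} (ht : 0 ≤ t) (ht0 : t = 0 → 0 < A + B) (n : ℕ) :
    0 < hankelDet α γ A B n t := by
  rw [hankelDet_eq_prod hα hγ hA hAB hne ht ht0]
  exact Finset.prod_pos fun j _ => opNorm_pos (laguerreFunctional_pos hα hγ hA hAB hne ht ht0) j

lemma hankelDet_eventuallyEq {t : ℝ} (ht : 0 ≤ t) (ht0 : t = 0 → 0 < A + B) (n : ℕ) :
    hankelDet α γ A B n =ᶠ[𝓝[Ici 0] t]
      fun s => ∏ j ∈ Finset.range n, opNorm (laguerreFunctional α γ A B s) j := by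
  rcases ht.eq_or_lt with rfl | ht
  · filter_upwards [self_mem_nhdsWithin] with s hs
    exact hankelDet_eq_prod hα hγ hA hAB hne hs (fun _ => ht0 rfl) n
  · filter_upwards [nhdsWithin_le_nhds (Ioi_mem_nhds ht)] with s hs
    have hs' : 0 < s := hs
    exact hankelDet_eq_prod hα hγ hA hAB hne hs'.le (fun h => absurd h hs'.ne') n

lemma hasDerivWithinAt_laguerre_opNorm {t : ℝ} (ht : 0 ≤ t) (ht0 : t = 0 → 0 < A + B) (j : ℕ) :
    HasDerivWithinAt (fun s => opNorm (laguerreFunctional α γ A B s) j)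
      (momentFunctional (momentDeriv α γ A B t)
        (op (laguerreFunctional α γ A B t) j * op (laguerreFunctional α γ A B t) j)) (Ici 0) t :=
  hasDerivWithinAt_opNorm (hasDerivWithinAt_moment hα hγ ht)
    (laguerreFunctional_pos hα hγ hA hAB hne ht ht0) j

lemma differentiableWithinAt_hankelDet {t : ℝ} (ht : 0 ≤ t) (ht0 : t = 0 → 0 < A + B) (n : ℕ) :
    DifferentiableWithinAt ℝ (hankelDet α γ A B n) (Ici 0) t := by
  have h : DifferentiableWithinAt ℝ
      (fun s => ∏ j ∈ Finset.range n, opNorm (laguerreFunctional α γ A B s) j) (Ici 0) t :=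
    DifferentiableWithinAt.fun_finsetProd fun j _ =>
      (hasDerivWithinAt_laguerre_opNorm hα hγ hA hAB hne ht ht0 j).differentiableWithinAt
  exact h.congr_of_eventuallyEq_of_mem (hankelDet_eventuallyEq hα hγ hA hAB hne ht ht0 n) ht

/-- The logarithmic derivative of `D_n = h_0 ⋯ h_{n-1}`. -/
lemma H_eq_sum {t : ℝ} (ht : 0 ≤ t) (ht0 : t = 0 → 0 < A + B) (n : ℕ) :
    H α γ A B n t = t * ∑ j ∈ Finset.range n, momentFunctional (momentDeriv α γ A B t)
      (op (laguerreFunctional α γ A B t) j * op (laguerreFunctional α γ A B t) j)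
        / opNorm (laguerreFunctional α γ A B t) j := by
  have hL := laguerreFunctional_pos hα hγ hA hAB hne ht ht0
  have h : HasDerivWithinAt (fun s => ∑ j ∈ Finset.range n,
      Real.log (opNorm (laguerreFunctional α γ A B s) j))
      (∑ j ∈ Finset.range n, momentFunctional (momentDeriv α γ A B t)
      (op (laguerreFunctional α γ A B t) j * op (laguerreFunctional α γ A B t) j)
        / opNorm (laguerreFunctional α γ A B t) j) (Ici 0) t :=
    HasDerivWithinAt.fun_sum fun j _ =>
      (hasDerivWithinAt_laguerre_opNorm hα hγ hA hAB hne ht ht0 j).log (opNorm_pos hL j).ne'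
  have he : (fun s => Real.log (hankelDet α γ A B n s)) =ᶠ[𝓝[Ici 0] t] fun s =>
      ∑ j ∈ Finset.range n, Real.log (opNorm (laguerreFunctional α γ A B s) j) := by
    rcases ht.eq_or_lt with rfl | ht
    · filter_upwards [self_mem_nhdsWithin] with s hs
      rw [hankelDet_eq_prod hα hγ hA hAB hne hs (fun _ => ht0 rfl) n, Real.log_prod]
      exact fun j _ => (opNorm_pos
        (laguerreFunctional_pos hα hγ hA hAB hne hs (fun _ => ht0 rfl)) j).ne'
    · filter_upwards [nhdsWithin_le_nhds (Ioi_mem_nhds ht)] with s hs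
      have hs' : 0 < s := hs
      rw [hankelDet_eq_prod hα hγ hA hAB hne hs'.le (fun h => absurd h hs'.ne') n, Real.log_prod]
      exact fun j _ => (opNorm_pos
        (laguerreFunctional_pos hα hγ hA hAB hne hs'.le (fun h => absurd h hs'.ne')) j).ne'
  have hd := h.congr_of_eventuallyEq_of_mem he ht
  rw [H, hd.derivWithin (uniqueDiffOn_Ici 0 t ht)]

/-- For `t > 0`, `H_n` is the subleading coefficient of `P_n` up to a constant. -/
lemma H_eq_subCoeff {t : ℝ} (ht : 0 < t) (n : ℕ) :
    H α γ A B n t = n * (n + α + γ) + subCoeff (laguerreFunctional α γ A B t) n := by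
  have hL := laguerreFunctional_pos hα hγ hA hAB hne ht.le (fun h => absurd h ht.ne')
  rw [H_eq_sum hα hγ hA hAB hne ht.le (fun h => absurd h ht.ne'), Finset.mul_sum]
  induction n with
  | zero => simp
  | succ n ih =>
    rw [Finset.sum_range_succ, ih, subCoeff_succ, ← mul_div_assoc,
      scaling_opNorm hL (isScaling_laguerreFunctional hα hγ ht), mul_div_assoc,
      div_self (opNorm_pos hL n).ne']
    push_cast
    ring

lemma hasDerivAt_H {t : ℝ} (ht : 0 < t) (n : ℕ) :
    HasDerivAt (H α γ A B n) ((subCoeff (laguerreFunctional α γ A B t) n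
      + recB (laguerreFunctional α γ A B t) n) / t) t := by
  have h := hasDerivAt_subCoeff (fun t ht k => hasDerivAt_moment (A := A) (B := B) hα hγ ht k)
    (fun t ht => laguerreFunctional_pos hα hγ hA hAB hne ht.le (fun h => absurd h ht.ne'))
    (fun t ht => isScaling_laguerreFunctional hα hγ ht) ht n
  refine (h.const_add (n * (n + α + γ))).congr_of_eventuallyEq ?_
  filter_upwards [Ioi_mem_nhds ht] with s hs
  exact H_eq_subCoeff hα hγ hA hAB hne hs n

lemma hasDerivAt_deriv_H_succ {t : ℝ} (ht : 0 < t) (m : ℕ) :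
    HasDerivAt (deriv (H α γ A B (m + 1))) (recB (laguerreFunctional α γ A B t) (m + 1) *
      (2 + recA (laguerreFunctional α γ A B t) m - recA (laguerreFunctional α γ A B t) (m + 1))
        / t / t) t := by
  have hs := fun t ht => laguerreFunctional_pos (t := t) hα hγ hA hAB hne (le_of_lt ht)
    (fun h => absurd h (ne_of_gt ht))
  have h1 := hasDerivAt_subCoeff (fun t ht k => hasDerivAt_moment (A := A) (B := B) hα hγ ht k)
    hs (fun t ht => isScaling_laguerreFunctional hα hγ ht) ht (m + 1)
  have h2 := hasDerivAt_recB_succ (fun t ht k => hasDerivAt_moment (A := A) (B := B) hα hγ ht k)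
    hs (fun t ht => isScaling_laguerreFunctional hα hγ ht) ht m
  have h3 := (h1.fun_add h2).fun_div (hasDerivAt_id t) ht.ne'
  refine (h3.congr_of_eventuallyEq ?_).congr_deriv ?_
  · filter_upwards [Ioi_mem_nhds ht] with s hs
    exact (hasDerivAt_H hα hγ hA hAB hne hs (m + 1)).deriv
  · simp only [id]
    have := ht.ne'
    field_simp
    ring

omit hα hγ hA hAB hne in
lemma H_zero_index : H α γ A B 0 = 0 := by
  ext t
  have : (fun s => Real.log (hankelDet α γ A B 0 s)) = fun _ => 0 := by
    ext s; simp [hankelDet]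
  simp [H, this]

omit hα hγ hA hAB hne in
lemma H_apply_zero (n : ℕ) : H α γ A B n 0 = 0 := by simp [H]

/-- The slope of `H_n` at `0` is the logarithmic derivative of `D_n` there, and each norm `h_j`
contributes `-γ / (α + γ)`. -/
lemma hasDerivWithinAt_H_zero (h0 : 0 < A + B) (n : ℕ) :
    HasDerivWithinAt (H α γ A B n) (-(n * γ / (α + γ))) (Ici 0) 0 := by
  set φ : ℝ → ℝ := fun t => ∑ j ∈ Finset.range n, momentFunctional (momentDeriv α γ A B t)
      (op (laguerreFunctional α γ A B t) j * op (laguerreFunctional α γ A B t) j)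
        / opNorm (laguerreFunctional α γ A B t) j with hφ
  have hL := laguerreFunctional_pos hα hγ hA hAB hne le_rfl (fun _ => h0)
  have hμ := hasDerivWithinAt_moment (A := A) (B := B) hα hγ (le_refl 0)
  have hν : ∀ k, ContinuousWithinAt (fun s => momentDeriv α γ A B s k) (Ici 0) 0 := fun k =>
    have hk : 0 < (k : ℝ) + α := by positivity
    ((continuousWithinAt_kernelIntegral_zero hγ (by linarith)).const_mul _).sub
      (continuousWithinAt_kernelIntegral_zero hγ (by linarith))
  have hcont : ContinuousWithinAt φ (Ici 0) 0 := by
    refine tendsto_finsetSum _ fun j _ => ContinuousWithinAt.div ?_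
      (hasDerivWithinAt_opNorm hμ hL j).continuousWithinAt (opNorm_pos hL j).ne'
    obtain ⟨⟨P', -, dP⟩, -⟩ := hasPolyDerivWithinAt_opPair hμ hL j
    exact continuousWithinAt_momentFunctional hν (dP.mul dP)
  have hval : φ 0 = -(n * γ / (α + γ)) := by
    have hterm : ∀ j, momentFunctional (momentDeriv α γ A B 0)
        (op (laguerreFunctional α γ A B 0) j * op (laguerreFunctional α γ A B 0) j)
        / opNorm (laguerreFunctional α γ A B 0) j = -(γ / (α + γ)) := by
      intro j
      set P := op (laguerreFunctional α γ A B 0) j with hP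
      have h1 := momentDeriv_zero (A := A) (B := B) hα hγ (P * P)
      have h2 : laguerreFunctional α γ A B 0 (derivative (P * P)) = 0 := by
        have hsplit : derivative (P * P) = C 2 * (P * derivative P) := by
          rw [derivative_mul, map_ofNat]; ring
        rw [hsplit, functional_C_mul, functional_op_mul_eq_zero hL j, mul_zero]
        have hd := degree_op_lt (L := laguerreFunctional α γ A B 0) j
        rw [degree_lt_iff_coeff_zero] at hd ⊢
        intro k hk
        rw [coeff_derivative, hd (k + 1) (by omega), zero_mul]
      rw [map_sub, h2, sub_zero, hP, ← opNorm, ← hP] at h1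
      have h3 := (opNorm_pos hL j).ne'
      field_simp
      linarith
    simp only [hφ, hterm, Finset.sum_const, Finset.card_range, nsmul_eq_mul]
    ring
  rw [hasDerivWithinAt_iff_tendsto_slope, ← hval]
  have hc : Tendsto φ (𝓝[Ici 0 \ {0}] 0) (𝓝 (φ 0)) := hcont.mono sdiff_subset
  refine hc.congr' ?_
  filter_upwards [self_mem_nhdsWithin] with s hs
  have hs0 : s ≠ 0 := hs.2
  rw [slope_def_field, H_apply_zero, H_eq_sum hα hγ hA hAB hne hs.1 (fun _ => h0), sub_zero,
    sub_zero, mul_div_cancel_left₀ _ hs0]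

/-! ### The differential and difference equations -/

/-- Multiplied by `t²`, the equation reads `(b (y - x))² = (b (x + y))² - 4 b² x y`, where
`x = H_n - H_{n+1}` and `y = H_{n-1} - H_n`. -/
lemma hDiffEqAt_H {t : ℝ} (ht : 0 < t) (n : ℕ) : HDiffEqAt α γ n (H α γ A B n) t := by
  rcases n with _ | m
  · have h0 : deriv (0 : ℝ → ℝ) = 0 := by ext; simp
    simp [HDiffEqAt, H_zero_index, h0]
  have hL := laguerreFunctional_pos hα hγ hA hAB hne ht.le (fun h => absurd h ht.ne')
  obtain ⟨e1, e2⟩ := quadratic_relations hL (isPearson_laguerreFunctional hα hγ ht.le) m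
  rw [HDiffEqAt, (hasDerivAt_deriv_H_succ hα hγ hA hAB hne ht m).deriv,
    (hasDerivAt_H hα hγ hA hAB hne ht (m + 1)).deriv, H_eq_subCoeff hα hγ hA hAB hne ht]
  set b := recB (laguerreFunctional α γ A B t) (m + 1)
  set p := subCoeff (laguerreFunctional α γ A B t) (m + 1)
  set a := recA (laguerreFunctional α γ A B t) (m + 1)
  set a₀ := recA (laguerreFunctional α γ A B t) m
  have ht' := ht.ne'
  set r := (p + b) / t with hr
  have hpb : p = t * r - b := by rw [hr]; field_simp; ring
  set x := a - 2 * (m + 1) - 1 - α - γ with hx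
  set y := a₀ - 2 * m - 1 - α - γ with hy
  have hd : t * (b * (2 + a₀ - a) / t / t) = b * (y - x) / t := by
    rw [hx, hy]; field_simp; ring
  rw [hpb] at e1 e2 ⊢
  have hlin :
      t * (b * (x + y) - t * (b - (m + 1) * (m + 1 + α) - (2 * (m + 1) + α + γ) * r)) = 0 := by
    linear_combination e2 - e1
  have hlin' := (mul_eq_zero.1 hlin).resolve_left ht'
  rw [hd, div_pow, div_eq_iff (by positivity)]
  push_cast
  have hsum : b * (x + y) = t * (b - (m + 1) * (m + 1 + α) - (2 * (m + 1) + α + γ) * r) := by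
    linarith
  linear_combination (b * (x + y) + t * (b - (m + 1) * (m + 1 + α) - (2 * (m + 1) + α + γ) * r))
    * hsum + 4 * b * e1

/-- Subtracting the two quadratic relations gives a linear equation, which expresses `H_n'` and
`b_n` rationally through `H_{n-1}`, `H_n`, `H_{n+1}`. -/
lemma hDifferenceEq_H {t : ℝ} (ht : 0 < t) (m : ℕ) :
    HDifferenceEq α γ (m + 1) t (H α γ A B m t) (H α γ A B (m + 1) t) (H α γ A B (m + 2) t) := by
  have hL := laguerreFunctional_pos hα hγ hA hAB hne ht.le (fun h => absurd h ht.ne')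
  obtain ⟨e1, e2⟩ := quadratic_relations hL (isPearson_laguerreFunctional hα hγ ht.le) m
  have hp1 := subCoeff_succ (L := laguerreFunctional α γ A B t) (m + 1)
  have hp0 := subCoeff_succ (L := laguerreFunctional α γ A B t) m
  have hm := H_eq_subCoeff hα hγ hA hAB hne ht m
  have h := H_eq_subCoeff hα hγ hA hAB hne ht (m + 1)
  have hp := H_eq_subCoeff hα hγ hA hAB hne ht (m + 2)
  set b := recB (laguerreFunctional α γ A B t) (m + 1)
  set x := recA (laguerreFunctional α γ A B t) (m + 1) - 2 * (m + 1) - 1 - α - γ with hx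
  set y := recA (laguerreFunctional α γ A B t) m - 2 * m - 1 - α - γ with hy
  push_cast at hm h hp
  set h₁ := H α γ A B (m + 1) t
  have hm' : H α γ A B m t = h₁ + y := by rw [hm, h, hp0, hy]; ring
  have hp' : H α γ A B (m + 2) t = h₁ - x := by rw [hp, h, hp1, hx]; ring
  have hsub : subCoeff (laguerreFunctional α γ A B t) (m + 1)
      = h₁ - (m + 1) * (m + 1 + α + γ) := by rw [h]; ring
  rw [hsub] at e1 e2
  rw [HDifferenceEq, hm', hp']
  push_cast
  set N : ℝ := (m : ℝ) + 1
  set u := h₁ - N * (N + α + γ) + b with hu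
  have hlin : t * (b * (t - x - y) - (t * (N * (N + α)) + (2 * N + α + γ) * u)) = 0 := by
    rw [hu]; linear_combination e1 - e2
  have hlin' := (mul_eq_zero.1 hlin).resolve_left ht.ne'
  -- With `u = t H_n'` and `K = 2 N + α + γ - t + (x + y)`, the brackets on the left are `u K` and
  -- `(u - γ t) K`, and the first one on the right is `b K`.
  have hX : N * γ * t - t * h₁ - (N * (N + α + γ) - h₁) * (x + y)
      = u * (2 * N + α + γ - t + (x + y)) := by
    rw [hu] at hlin' ⊢; linear_combination hlin'
  have hX' : (t - N - α - γ) * γ * t - t * h₁ - (N * (N + α + γ) + γ * t - h₁) * (x + y)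
      = (u - γ * t) * (2 * N + α + γ - t + (x + y)) := by
    linear_combination hX
  have hZ : N * γ * t + N * (N + α + γ) * (2 * N + α + γ - t) - (2 * N + α + γ) * h₁
      = b * (2 * N + α + γ - t + (x + y)) := by
    rw [hu] at hX; linear_combination hX
  have es : h₁ + y - (h₁ - x) = x + y := by ring
  have ek : 2 * N + α + γ - t + (h₁ + y) - (h₁ - x) = 2 * N + α + γ - t + (x + y) := by ring
  rw [es, ek, hX, hX', hZ]
  linear_combination (2 * N + α + γ - t + (x + y)) ^ 2 * e1

end

/-- The `σ`-form of Painlevé V for `h - n γ` is the equation for `h`. -/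
lemma sigmaFormPVAt_sub_const {h : ℝ → ℝ} {n : ℕ} {t : ℝ} (hh : HDiffEqAt α γ n h t) :
    SigmaFormPVAt 0 n (n + α) (-γ) (fun s => h s - n * γ) t := by
  have hd : deriv (fun s => h s - n * γ) = deriv h := by
    ext s; rw [deriv_sub_const_fun]
  rw [SigmaFormPVAt, hd]
  rw [HDiffEqAt] at hh
  rw [hh]
  ring

lemma discreteSigmaFormPV_sub_const {m : ℕ} {t hm h hp : ℝ}
    (hh : HDifferenceEq α γ (m + 1) t hm h hp) :
    DiscreteSigmaFormPV α γ (m + 1) t (hm - m * γ) (h - (m + 1 : ℕ) * γ) (hp - (m + 2 : ℕ) * γ) := by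
  rw [HDifferenceEq] at hh
  rw [DiscreteSigmaFormPV]
  push_cast at hh ⊢
  linear_combination hh

end PerturbedLaguerre

end

theorem mainTheorem1 (α γ A B : ℝ) (hα : 0 < α) (hγ : 0 < γ) (hA : 0 ≤ A) (hAB : 0 ≤ A + B)
    (hne : A ≠ 0 ∨ B ≠ 0) :
    -- `D_n` is positive and differentiable, so that `H_n` and `σ_n` are well defined,
    (∀ (n : ℕ) (t : ℝ), 0 ≤ t → (t = 0 → 0 < A + B) →
      0 < PerturbedLaguerre.hankelDet α γ A B n t ∧
      DifferentiableWithinAt ℝ (PerturbedLaguerre.hankelDet α γ A B n) (Set.Ici 0) t) ∧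
    -- and `H_n`, `σ_n` are twice differentiable on `(0, ∞)`.
    (∀ (n : ℕ) (t : ℝ), 0 < t →
      DifferentiableAt ℝ (PerturbedLaguerre.H α γ A B n) t ∧
      DifferentiableAt ℝ (deriv (PerturbedLaguerre.H α γ A B n)) t ∧
      DifferentiableAt ℝ (PerturbedLaguerre.sigma α γ A B n) t ∧
      DifferentiableAt ℝ (deriv (PerturbedLaguerre.sigma α γ A B n)) t) ∧
    -- The differential equations for `σ_n` and `H_n`.
    (∀ (n : ℕ) (t : ℝ), 0 < t →
      PerturbedLaguerre.SigmaFormPVAt 0 n (n + α) (-γ) (PerturbedLaguerre.sigma α γ A B n) t ∧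
      PerturbedLaguerre.HDiffEqAt α γ n (PerturbedLaguerre.H α γ A B n) t) ∧
    -- The initial conditions at `t = 0`.
    (0 < A + B → ∀ n : ℕ,
      PerturbedLaguerre.sigma α γ A B n 0 = -(n * γ) ∧
      HasDerivWithinAt (PerturbedLaguerre.sigma α γ A B n) (-(n * γ / (α + γ))) (Set.Ici 0) 0 ∧
      PerturbedLaguerre.H α γ A B n 0 = 0 ∧
      HasDerivWithinAt (PerturbedLaguerre.H α γ A B n) (-(n * γ / (α + γ))) (Set.Ici 0) 0) ∧
    -- The difference equations in `n`.
    (∀ (n : ℕ) (t : ℝ), 1 ≤ n → 0 ≤ t → (t = 0 → 0 < A + B) →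
      PerturbedLaguerre.DiscreteSigmaFormPV α γ n t (PerturbedLaguerre.sigma α γ A B (n - 1) t)
        (PerturbedLaguerre.sigma α γ A B n t) (PerturbedLaguerre.sigma α γ A B (n + 1) t) ∧
      PerturbedLaguerre.HDifferenceEq α γ n t (PerturbedLaguerre.H α γ A B (n - 1) t)
        (PerturbedLaguerre.H α γ A B n t) (PerturbedLaguerre.H α γ A B (n + 1) t)) := by
  open PerturbedLaguerre in
  have hσ : ∀ n, sigma α γ A B n = fun t => H α γ A B n t - n * γ := fun n => rfl
  have hdσ : ∀ n, deriv (sigma α γ A B n) = deriv (H α γ A B n) := by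
    intro n; ext t; rw [hσ, deriv_sub_const_fun]
  have hd : ∀ (n : ℕ) (t : ℝ), 0 < t → DifferentiableAt ℝ (H α γ A B n) t ∧
      DifferentiableAt ℝ (deriv (H α γ A B n)) t := by
    intro n t ht
    refine ⟨(hasDerivAt_H hα hγ hA hAB hne ht n).differentiableAt, ?_⟩
    rcases n with _ | m
    · have h0 : deriv (0 : ℝ → ℝ) = 0 := by ext; simp
      rw [H_zero_index, h0]
      exact differentiableAt_const 0
    · exact (hasDerivAt_deriv_H_succ hα hγ hA hAB hne ht m).differentiableAt
  have hdiff : ∀ (m : ℕ) (t : ℝ), 0 ≤ t → HDifferenceEq α γ (m + 1) t (H α γ A B m t)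
      (H α γ A B (m + 1) t) (H α γ A B (m + 2) t) := by
    intro m t ht
    rcases ht.eq_or_lt with rfl | ht
    · simp [HDifferenceEq, H_apply_zero]
    · exact hDifferenceEq_H hα hγ hA hAB hne ht m
  refine ⟨fun n t ht ht0 => ⟨hankelDet_pos hα hγ hA hAB hne ht ht0 n,
    differentiableWithinAt_hankelDet hα hγ hA hAB hne ht ht0 n⟩, fun n t ht => ?_,
    fun n t ht => ?_, fun h0 n => ?_, fun n t hn ht _ => ?_⟩
  · obtain ⟨h1, h2⟩ := hd n t ht
    refine ⟨h1, h2, ?_, by rwa [hdσ]⟩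
    rw [hσ]
    exact h1.sub_const _
  · have h := hDiffEqAt_H hα hγ hA hAB hne ht n
    exact ⟨by rw [hσ]; exact sigmaFormPVAt_sub_const h, h⟩
  · have h := hasDerivWithinAt_H_zero hα hγ hA hAB hne h0 n
    refine ⟨by simp [hσ, H_apply_zero], ?_, H_apply_zero n, h⟩
    rw [hσ]
    exact h.sub_const _
  · obtain ⟨m, rfl⟩ : ∃ m, n = m + 1 := ⟨n - 1, by omega⟩
    have h := hdiff m t ht
    rw [Nat.add_sub_cancel]
    exact ⟨discreteSigmaFormPV_sub_const h, h⟩
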